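/- Let $\nu\ge 3$ be an integer and $a>0$ a real number, and let $S\subset\mathbb{C}^2$ be the curve $F=0$, where $F$ is either $(y^2-x^\nu)(y-ax)$ or $(y^2+x^\nu)(y-ax)$; it has degree $3$ in $y$. For $x\in\mathbb{C}$ put $K(x)=\{y: F(x,y)=0\}$, and let $N=\{x : |K(x)|<3\}$. Then for all sufficiently small $r>0$ the closed disc $E=\{|x|\le r\}$ satisfies $E\cap N=\{0\}$. Let $r>0$ be any radius with $E\cap N=\{0\}$, let $M=r\in\partial E$ be the base point, and let $D\subset\mathbb{C}$ be any closed disc whose interior contains $K(x)$ for all $x\in E$. Write $B_3$ for the group of geometric braids in $D\times[0,1]$ with end points $K(M)$, up to isotopy, that is, the fundamental group at $K(M)$ of the space of $3$-element subsets of $D$. Number the points of $K(M)$ from left to right by their real parts (points with equal real parts by increasing imaginary part, which is their order after a very small clockwise rotation), and let $\sigma_i\in B_3$ ($i=1,2$) be the positive (counterclockwise) half-twist along the segment joining the $i$-th and the $(i+1)$-st point. Then the braid monodromy of $S$ with respect to $E\times D$, i.e. the homomorphism $\varphi:\pi_1(E\setminus N,M)\to B_3$ sending the class of a loop to the braid formed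 by the $y$-coordinates of its three lifts to $S$, exists, and for the loop $\Gamma(t)=re^{2\pi i t}$, $t\in[0,1]$, $$\varphi([\Gamma])=\sigma_2\sigma_1\sigma_2^{\nu}\sigma_1\sigma_2 .$$ Moreover, the image of $\varphi$ is the cyclic subgroup generated by this braid. In this sense the local braid monodromy of each of the two curves at the origin is generated by $\sigma_2\sigma_1\sigma_2^{\nu}\sigma_1\sigma_2$. -/

import Mathlib

open Set

noncomputable section

namespace BraidMonodromy

/-! ### Configurations of points and geometric braids -/

/-- Ordered configurations of `n` distinct points of `D`. -/
abbrev Conf (D : Set ℂ) (n : ℕ) : Type :=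
  {z : Fin n → ℂ // Function.Injective z ∧ ∀ i, z i ∈ D}

/-- Unordered configurations: subsets of `D` with exactly `n` elements. -/
def UConf (D : Set ℂ) (n : ℕ) : Type :=
  {K : Set ℂ // K ⊆ D ∧ K.encard = n}

/-- Forget the numbering of a configuration. -/
def Conf.toUConf {D : Set ℂ} {n : ℕ} (z : Conf D n) : UConf D n :=
  ⟨Set.range z.1, by
    refine ⟨?_, ?_⟩
    · rintro _ ⟨i, rfl⟩
      exact z.2.2 i
    · rw [← Set.image_univ, z.2.1.encard_image]
      simp⟩

/-- The topology of the unordered configuration space: the quotient topology from ordered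
configurations. -/
instance (D : Set ℂ) (n : ℕ) : TopologicalSpace (UConf D n) :=
  TopologicalSpace.coinduced Conf.toUConf inferInstance

theorem Conf.continuous_toUConf {D : Set ℂ} {n : ℕ} :
    Continuous (Conf.toUConf : Conf D n → UConf D n) :=
  continuous_coinduced_rng

/-- The group of geometric braids in `D × [0,1]` whose strands begin and end at the points of `K`,
up to isotopy. -/
abbrev BraidGroup {D : Set ℂ} {n : ℕ} (K : UConf D n) : Type :=
  FundamentalGroup (UConf D n) K

/-- The path of unordered configurations traced by `n` disjoint strands
`t ↦ (s t).1 i` from `K` to `K`. -/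
def strandPath {D : Set ℂ} {n : ℕ} {K : UConf D n} (s : C(unitInterval, Conf D n))
    (h0 : (s 0).toUConf = K) (h1 : (s 1).toUConf = K) : Path K K where
  toFun t := (s t).toUConf
  continuous_toFun := Conf.continuous_toUConf.comp s.continuous
  source' := h0
  target' := h1

/-- The geometric braid with the given strands. -/
def geomBraid {D : Set ℂ} {n : ℕ} {K : UConf D n} (s : C(unitInterval, Conf D n))
    (h0 : (s 0).toUConf = K) (h1 : (s 1).toUConf = K) : BraidGroup K :=
  FundamentalGroup.fromPath (Path.Homotopic.Quotient.mk (strandPath s h0 h1))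

/-! ### The points of a configuration from left to right -/

/-- The key of the left-to-right order: real part first; points with the same real part are
compared by their imaginary parts, which is their left-to-right order after a very small
clockwise rotation. -/
def lexKey (z : ℂ) : ℝ ×ₗ ℝ := toLex (z.re, z.im)

theorem lexKey_injective : Function.Injective lexKey := by
  intro z w h
  have h' := toLex.injective h
  exact Complex.ext (Prod.ext_iff.1 h').1 (Prod.ext_iff.1 h').2

/-- The keys of the points of `K`. -/
def UConf.keys {D : Set ℂ} {n : ℕ} (K : UConf D n) : Finset (ℝ ×ₗ ℝ) :=
  ((Set.finite_of_encard_eq_coe K.2.2).image lexKey).toFinset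

theorem UConf.card_keys {D : Set ℂ} {n : ℕ} (K : UConf D n) : K.keys.card = n := by
  have h : (lexKey '' K.1).encard = n := by
    rw [lexKey_injective.encard_image]; exact K.2.2
  have h2 := ((Set.finite_of_encard_eq_coe K.2.2).image lexKey).encard_eq_coe_toFinset_card
  rw [h] at h2
  exact_mod_cast h2.symm

/-- The `i`-th point of `K` from the left (`i = 0, …, n - 1`). -/
def UConf.pt {D : Set ℂ} {n : ℕ} (K : UConf D n) (i : Fin n) : ℂ :=
  ⟨(ofLex (K.keys.orderEmbOfFin K.card_keys i)).1, (ofLex (K.keys.orderEmbOfFin K.card_keys i)).2⟩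

theorem UConf.lexKey_pt {D : Set ℂ} {n : ℕ} (K : UConf D n) (i : Fin n) :
    lexKey (K.pt i) = K.keys.orderEmbOfFin K.card_keys i := rfl

theorem UConf.strictMono_pt {D : Set ℂ} {n : ℕ} (K : UConf D n) :
    StrictMono fun i => lexKey (K.pt i) :=
  (K.keys.orderEmbOfFin K.card_keys).strictMono

theorem UConf.pt_injective {D : Set ℂ} {n : ℕ} (K : UConf D n) : Function.Injective K.pt :=
  fun _ _ h => K.strictMono_pt.injective (congrArg lexKey h)

theorem UConf.range_pt {D : Set ℂ} {n : ℕ} (K : UConf D n) : Set.range K.pt = K.1 := by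
  have h : lexKey '' Set.range K.pt = lexKey '' K.1 := by
    rw [← Set.range_comp]
    have : lexKey ∘ K.pt = K.keys.orderEmbOfFin K.card_keys := funext fun i => K.lexKey_pt i
    rw [this, Finset.range_orderEmbOfFin]
    simp [UConf.keys]
  exact lexKey_injective.image_injective h

/-! ### Half-twists -/

/-- The real affine map taking the segment from `-1` to `1` to the segment from `p` to `q`, and the
closed unit disc to a closed elliptic disc with that segment as an axis; the other axis is `ε` times
as long. -/
def ellipseMap (p q : ℂ) (ε : ℝ) (u : ℂ) : ℂ :=
  (p + q) / 2 + (q - p) / 2 * ((u.re : ℂ) + (ε * u.im : ℝ) * Complex.I)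

/-- The closed elliptic disc around the segment from `p` to `q`. -/
def ellipse (p q : ℂ) (ε : ℝ) : Set ℂ := ellipseMap p q ε '' Metric.closedBall 0 1

/-- The elliptic disc lies in `D` and contains no points of `K` except `p` and `q`. -/
def IsThin {D : Set ℂ} {n : ℕ} (K : UConf D n) (p q : ℂ) (ε : ℝ) : Prop :=
  p ≠ q ∧ 0 < ε ∧ ellipse p q ε ⊆ D ∧ K.1 ∩ ellipse p q ε = {p, q}

open Classical in
/-- The motion exchanging `p` and `q` counterclockwise along the boundary of the elliptic disc and
fixing all other points. -/
def twistMotion (p q : ℂ) (ε : ℝ) (t : ℝ) (w : ℂ) : ℂ :=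
  if w = p then ellipseMap p q ε (-Complex.exp (Real.pi * t * Complex.I))
  else if w = q then ellipseMap p q ε (Complex.exp (Real.pi * t * Complex.I))
  else w

theorem ellipseMap_injective {p q : ℂ} {ε : ℝ} (hpq : p ≠ q) (hε : 0 < ε) :
    Function.Injective (ellipseMap p q ε) := by
  intro u v h
  have h1 : (q - p) / 2 ≠ 0 := div_ne_zero (sub_ne_zero.2 hpq.symm) two_ne_zero
  have h2 := mul_left_cancel₀ h1 (add_left_cancel h)
  have hre := congrArg Complex.re h2
  have him := congrArg Complex.im h2
  simp at hre him
  exact Complex.ext hre (him.resolve_right hε.ne')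

theorem exp_mem_closedBall (t : ℝ) :
    Complex.exp (Real.pi * t * Complex.I) ∈ Metric.closedBall (0 : ℂ) 1 := by
  rw [mem_closedBall_zero_iff]
  have := Complex.norm_exp_ofReal_mul_I (Real.pi * t)
  push_cast at this
  exact this.le

theorem continuous_twistMotion (p q : ℂ) (ε : ℝ) (w : ℂ) :
    Continuous fun t : unitInterval => twistMotion p q ε t w := by
  unfold twistMotion ellipseMap
  split_ifs <;> fun_prop

theorem IsThin.twist_mem {D : Set ℂ} {n : ℕ} {K : UConf D n} {p q : ℂ} {ε : ℝ}
    (h : IsThin K p q ε) (t : ℝ) {w : ℂ} (hw : w ∈ K.1) : twistMotion p q ε t w ∈ D := by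
  have he := exp_mem_closedBall t
  unfold twistMotion
  split_ifs
  · exact h.2.2.1 ⟨_, by simpa using he, rfl⟩
  · exact h.2.2.1 ⟨_, he, rfl⟩
  · exact K.2.1 hw

theorem IsThin.twist_injOn {D : Set ℂ} {n : ℕ} {K : UConf D n} {p q : ℂ} {ε : ℝ}
    (h : IsThin K p q ε) (t : ℝ) : Set.InjOn (twistMotion p q ε t) K.1 := by
  have he := exp_mem_closedBall t
  have he' : -Complex.exp (Real.pi * t * Complex.I) ∈ Metric.closedBall (0 : ℂ) 1 := by
    simpa using he
  have hne : -Complex.exp (Real.pi * t * Complex.I) ≠ Complex.exp (Real.pi * t * Complex.I) := by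
    intro hh
    exact Complex.exp_ne_zero _ (self_eq_neg.1 hh.symm)
  have hout : ∀ w ∈ K.1, w ≠ p → w ≠ q → ∀ u ∈ Metric.closedBall (0 : ℂ) 1,
      ellipseMap p q ε u ≠ w := by
    intro w hw hp hq u hu huw
    have : w ∈ K.1 ∩ ellipse p q ε := ⟨hw, u, hu, huw⟩
    rw [h.2.2.2] at this
    rcases this with h' | h'
    · exact hp h'
    · exact hq h'
  have hinj := ellipseMap_injective h.1 h.2.1
  intro v hv w hw hvw
  unfold twistMotion at hvw
  split_ifs at hvw with h1 h2 h3 h4 h5 h6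
  · rw [h1, h2]
  · exact absurd (hinj hvw) hne
  · exact absurd hvw (hout w hw h2 h3 _ he')
  · exact absurd (hinj hvw).symm hne
  · rw [h4, h6]
  · exact absurd hvw (hout w hw h5 h6 _ he)
  · exact absurd hvw.symm (hout v hv h1 h4 _ he')
  · exact absurd hvw.symm (hout v hv h1 h4 _ he)
  · exact hvw

/-- The strands of the positive half-twist: the points of `K`, numbered from the left, moved by
`twistMotion`. -/
def twistStrands {D : Set ℂ} {n : ℕ} (K : UConf D n) {p q : ℂ} {ε : ℝ} (h : IsThin K p q ε) :
    C(unitInterval, Conf D n) where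
  toFun t := ⟨fun i => twistMotion p q ε t (K.pt i),
    fun i j hij => K.pt_injective (h.twist_injOn t (K.range_pt ▸ Set.mem_range_self i)
      (K.range_pt ▸ Set.mem_range_self j) hij),
    fun i => h.twist_mem t (K.range_pt ▸ Set.mem_range_self i)⟩
  continuous_toFun :=
    Continuous.subtype_mk (continuous_pi fun i => continuous_twistMotion p q ε (K.pt i)) _

theorem twistStrands_zero {D : Set ℂ} {n : ℕ} (K : UConf D n) {p q : ℂ} {ε : ℝ}
    (h : IsThin K p q ε) : (twistStrands K h 0).toUConf = K := by
  have h0 : ∀ w, twistMotion p q ε 0 w = w := by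
    intro w
    unfold twistMotion ellipseMap
    split_ifs with h1 h2
    · simp [h1]; ring
    · simp [h2]; ring
    · rfl
  refine Subtype.ext ?_
  change Set.range (fun i => twistMotion p q ε ((0 : unitInterval) : ℝ) (K.pt i)) = K.1
  simp only [Set.Icc.coe_zero, h0]
  exact K.range_pt

theorem twistStrands_one {D : Set ℂ} {n : ℕ} (K : UConf D n) {p q : ℂ} {ε : ℝ}
    (h : IsThin K p q ε) : (twistStrands K h 1).toUConf = K := by
  have hm : ∀ w, twistMotion p q ε 1 w = Equiv.swap p q w := by
    intro w
    rw [Equiv.swap_apply_def]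
    unfold twistMotion ellipseMap
    split_ifs with h1 h2
    · simp [Complex.exp_pi_mul_I]; ring
    · simp [Complex.exp_pi_mul_I]; ring
    · rfl
  have hpK : p ∈ K.1 := (h.2.2.2.symm ▸ Set.mem_insert p {q} : p ∈ K.1 ∩ ellipse p q ε).1
  have hqK : q ∈ K.1 := (h.2.2.2.symm ▸ Set.mem_insert_of_mem p rfl : q ∈ K.1 ∩ ellipse p q ε).1
  have hmem : ∀ w ∈ K.1, Equiv.swap p q w ∈ K.1 := by
    intro w hw
    rw [Equiv.swap_apply_def]
    split_ifs
    exacts [hqK, hpK, hw]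
  refine Subtype.ext ?_
  change Set.range (fun i => twistMotion p q ε ((1 : unitInterval) : ℝ) (K.pt i)) = K.1
  simp only [Set.Icc.coe_one, hm]
  change Set.range (Equiv.swap p q ∘ K.pt) = K.1
  rw [Set.range_comp, K.range_pt]
  apply Set.Subset.antisymm
  · rintro _ ⟨w, hw, rfl⟩
    exact hmem w hw
  · intro w hw
    exact ⟨Equiv.swap p q w, hmem w hw, Equiv.swap_apply_self p q w⟩

open Classical in
/-- The positive half-twist along the segment from `p` to `q`: the two points are exchanged
counterclockwise in a thin neighbourhood of the segment. The braid does not depend on the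
neighbourhood. (The value is `1` if there is no such neighbourhood, that is, if `p` and `q` are not
distinct points of `K` joined by a segment free of other points of `K`, or if `D` leaves no
room.) -/
def halfTwist {D : Set ℂ} {n : ℕ} (K : UConf D n) (p q : ℂ) : BraidGroup K :=
  if h : ∃ ε, IsThin K p q ε then
    geomBraid (twistStrands K h.choose_spec) (twistStrands_zero K h.choose_spec)
      (twistStrands_one K h.choose_spec)
  else 1

/-- The standard generator `σᵢ`, `1 ≤ i ≤ n - 1`, of the braid group of `K`: the positive half-twist
along the segment joining the `i`-th and the `(i+1)`-st point of `K`, counted from the left. -/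
def artinGen {D : Set ℂ} {n : ℕ} (K : UConf D n) (i : ℕ) : BraidGroup K :=
  if h : 1 ≤ i ∧ i < n then halfTwist K (K.pt ⟨i - 1, by omega⟩) (K.pt ⟨i, h.2⟩) else 1

/-! ### Plane curves and their braid monodromy -/

/-- `K(x)`: the second coordinates of the points above `x` of the curve `F = 0`. A polynomial in
`y` with coefficients in `ℂ[x]` is written as an element of `ℂ[x][y]`. -/
def fiber (F : Polynomial (Polynomial ℂ)) (x : ℂ) : Set ℂ := {y | F.evalEval x y = 0}

/-- `N`: the points `x` above which the curve does not have exactly `n` points, `n` being the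
degree of `F` in `y`. (If the curve contains no vertical line, these are the points with
fewer than `n` points above them.) -/
def branchSet (F : Polynomial (Polynomial ℂ)) (n : ℕ) : Set ℂ := {x | (fiber F x).encard ≠ n}

/-- The configuration `K(x)` in `D`, for `x ∈ E \ N`. -/
def fiberConf (F : Polynomial (Polynomial ℂ)) (n : ℕ) {E D : Set ℂ}
    (hD : ∀ x ∈ E, fiber F x ⊆ D) (x : ↥(E \ branchSet F n)) : UConf D n :=
  ⟨fiber F x, hD x x.2.1, not_not.1 x.2.2⟩

/-- `φ : π₁(E \ N, M) → B(K(M))` is the braid monodromy of the curve `F = 0` with respect to `E × D`: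
every loop at `M` has `n` disjoint lifts to the curve, and `φ` takes the class of the loop to the
geometric braid formed by the second coordinates of these lifts. -/
def IsBraidMonodromy (F : Polynomial (Polynomial ℂ)) (n : ℕ) {E D : Set ℂ}
    (hD : ∀ x ∈ E, fiber F x ⊆ D) (M : ↥(E \ branchSet F n))
    (φ : FundamentalGroup ↥(E \ branchSet F n) M →* BraidGroup (fiberConf F n hD M)) : Prop :=
  ∀ γ : Path M M, ∃ (s : C(unitInterval, Conf D n)) (h0 : (s 0).toUConf = fiberConf F n hD M)
    (h1 : (s 1).toUConf = fiberConf F n hD M),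
    (∀ t i, F.evalEval (γ t : ℂ) ((s t).1 i) = 0) ∧
    φ (FundamentalGroup.fromPath (Path.Homotopic.Quotient.mk γ)) = geomBraid s h0 h1

/-- The braid monodromy is unique. -/
theorem IsBraidMonodromy.unique {F : Polynomial (Polynomial ℂ)} {n : ℕ} {E D : Set ℂ}
    {hD : ∀ x ∈ E, fiber F x ⊆ D} {M : ↥(E \ branchSet F n)}
    {φ ψ : FundamentalGroup ↥(E \ branchSet F n) M →* BraidGroup (fiberConf F n hD M)}
    (hφ : IsBraidMonodromy F n hD M φ) (hψ : IsBraidMonodromy F n hD M ψ) : φ = ψ := by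
  have key : ∀ (γ : Path M M) (s : C(unitInterval, Conf D n)),
      (∀ t i, F.evalEval (γ t : ℂ) ((s t).1 i) = 0) →
      ∀ t, (s t).toUConf = fiberConf F n hD (γ t) := by
    intro γ s hs t
    refine Subtype.ext ?_
    have hsub : (s t).toUConf.1 ⊆ (fiberConf F n hD (γ t)).1 := by
      rintro _ ⟨i, rfl⟩
      exact hs t i
    refine (Set.finite_of_encard_eq_coe
      (s t).toUConf.2.2).eq_of_subset_of_encard_le hsub ?_
    rw [(fiberConf F n hD (γ t)).2.2, (s t).toUConf.2.2]
  refine MonoidHom.ext fun g => ?_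
  obtain ⟨γ, rfl⟩ := Path.Homotopic.Quotient.mk_surjective g
  obtain ⟨s, h0, h1, hs, e⟩ := hφ γ
  obtain ⟨s', h0', h1', hs', e'⟩ := hψ γ
  refine e.trans (Eq.trans ?_ e'.symm)
  have : strandPath s h0 h1 = strandPath s' h0' h1' := by
    ext t
    exact (key γ s hs t).trans (key γ s' hs' t).symm
  unfold geomBraid
  rw [this]

/-! ### The local situation at the origin -/

theorem circle_mem {N : Set ℂ} {r : ℝ} (hr : 0 < r) (hN : Metric.closedBall 0 r ∩ N = {0}) (t : ℝ) :
    (r : ℂ) * Complex.exp (2 * Real.pi * t * Complex.I) ∈ Metric.closedBall 0 r \ N := by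
  have hn : ‖(r : ℂ) * Complex.exp (2 * Real.pi * t * Complex.I)‖ = r := by
    have := Complex.norm_exp_ofReal_mul_I (2 * Real.pi * t)
    push_cast at this
    rw [norm_mul, this, mul_one, Complex.norm_real, Real.norm_of_nonneg hr.le]
  have hm : (r : ℂ) * Complex.exp (2 * Real.pi * t * Complex.I) ∈ Metric.closedBall (0 : ℂ) r := by
    rw [mem_closedBall_zero_iff, hn]
  refine ⟨hm, fun h => ?_⟩
  have h0 : (r : ℂ) * Complex.exp (2 * Real.pi * t * Complex.I) = 0 := by
    have : (r : ℂ) * Complex.exp (2 * Real.pi * t * Complex.I) ∈ Metric.closedBall (0 : ℂ) r ∩ N :=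
      ⟨hm, h⟩
    rwa [hN] at this
  rw [h0, norm_zero] at hn
  exact hr.ne hn

/-- The base point `M = r` on the boundary of the disc of radius `r`. -/
def basePoint {N : Set ℂ} {r : ℝ} (hr : 0 < r) (hN : Metric.closedBall 0 r ∩ N = {0}) :
    ↥(Metric.closedBall (0 : ℂ) r \ N) :=
  ⟨r, by simpa using circle_mem hr hN 0⟩

/-- The loop `Γ(t) = r e^{2πit}`. -/
def circleLoop {N : Set ℂ} {r : ℝ} (hr : 0 < r) (hN : Metric.closedBall 0 r ∩ N = {0}) :
    Path (basePoint hr hN) (basePoint hr hN) where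
  toFun t := ⟨r * Complex.exp (2 * Real.pi * (t : ℝ) * Complex.I), circle_mem hr hN t⟩
  continuous_toFun := by
    apply Continuous.subtype_mk
    fun_prop
  source' := by
    refine Subtype.ext ?_
    simp [basePoint]
  target' := by
    refine Subtype.ext ?_
    simp [basePoint, Complex.exp_two_pi_mul_I]

/-- The curve `(y² - x^ν)(y - a x) = 0`. -/
def curveG1 (ν : ℕ) (a : ℝ) : Polynomial (Polynomial ℂ) :=
  (Polynomial.X ^ 2 - Polynomial.C (Polynomial.X ^ ν)) *
    (Polynomial.X - Polynomial.C (Polynomial.C (a : ℂ) * Polynomial.X))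

/-- The curve `(y² + x^ν)(y - a x) = 0`. -/
def curveG2 (ν : ℕ) (a : ℝ) : Polynomial (Polynomial ℂ) :=
  (Polynomial.X ^ 2 + Polynomial.C (Polynomial.X ^ ν)) *
    (Polynomial.X - Polynomial.C (Polynomial.C (a : ℂ) * Polynomial.X))

end BraidMonodromy

end

open BraidMonodromy Metric

noncomputable section

namespace BraidMonodromy

/-! ### Homotopies of paths -/

section Homotopy

variable {X : Type*} [TopologicalSpace X]

/-! Both curves have the form $(y^2-\zeta^2x^\nu)(y-ax)=0$ with $\zeta=1$ or $\zeta=i$. Over $x=e^u$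
the points are $\pm\zeta e^{\nu u/2}$ and $ae^u$. A radius $r$ with $E\cap N=\{0\}$ satisfies
$r^{\nu-2}<a^2$ (`IsTangentCurve.pow_lt`): otherwise the line would meet the other branch over a
nonzero point of $E$. So over the circle $\Gamma$ the pair $\pm w$, $w=\zeta r^{\nu/2}$, makes $\nu$
half turns inside the circle of radius $P=ar$, on which the third point makes one full turn.

Turning the pair and turning the third point are independent motions. They form a map from $\mathbb
R^2$ to configurations that is periodic under $\mathbb Z^2$, and hence give a homomorphism
`torusHom` from $\mathbb Z^2$ to the braid group; the braid of $\Gamma$ is the value at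
$(\nu,1)=(\nu-2)(1,0)+(2,1)$. The value at $(1,0)$ is $\sigma_1$ (`torusHom_one_zero`). The value at
$(2,1)$ is a rigid full turn of all three points, and equals $(\sigma_2\sigma_1)^3$
(`pair_relations`). The braid relation then turns $\sigma_1^{\nu-2}(\sigma_2\sigma_1)^3$ into the
required word (`braid_pow`).

Both the formula for the full turn and the braid relation are proved on an equilateral triangle, to
which $-w,w,P$ is deformed while the two half-twists are carried along (`halfTwist_transport`).
There a third of a turn $\delta$ is a loop. It equals $\sigma_2\sigma_1$ (`thirdTurn_eq_mul`),
because a two-parameter family over a simplex has the two half-twists on its legs and, up to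
homotopy, $\delta$ on its diagonal. Rotation carries one side to the next, so
$\delta\sigma_2=\sigma_1\delta$ (`thirdTurn_conj`); substituting $\delta=\sigma_2\sigma_1$ gives the
braid relation.

The monodromy itself is the map on fundamental groups induced by $x\mapsto K(x)$, which is
continuous because the sheets are continuous in a local logarithm. Its image is cyclic because
$\Gamma$ generates the fundamental group of the punctured disc (`zpowers_circleLoop`). -/

/-- The images of two paths with the same end points in a simply connected space are homotopic. -/
theorem homotopic_of_simplyConnected {E : Type*} [TopologicalSpace E] [SimplyConnectedSpace E]
    (ψ : C(E, X)) {u v : E} (p q : Path u v) {x y : X} (γ δ : Path x y)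
    (hγ : ∀ t, γ t = ψ (p t)) (hδ : ∀ t, δ t = ψ (q t)) : γ.Homotopic δ := by
  have hx : x = ψ u := by simpa using hγ 0
  have hy : y = ψ v := by simpa using hγ 1
  subst hx hy
  have e1 : γ = p.map ψ.continuous := by ext t; exact hγ t
  have e2 : δ = q.map ψ.continuous := by ext t; exact hδ t
  rw [e1, e2]
  exact (SimplyConnectedSpace.paths_homotopic p q).map ψ

/-- The two ways around a square are homotopic. -/
theorem homotopic_of_square (H : C(unitInterval × unitInterval, X)) {a b c d : X}
    (p : Path a b) (q : Path c d) (g : Path a c) (g' : Path b d)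
    (hp : ∀ t, H (0, t) = p t) (hq : ∀ t, H (1, t) = q t)
    (hg : ∀ s, H (s, 0) = g s) (hg' : ∀ s, H (s, 1) = g' s) :
    (p.trans g').Homotopic (g.trans q) := by
  have : ContractibleSpace (unitInterval × unitInterval) := by
    have : ContractibleSpace unitInterval :=
      (convex_Icc (0 : ℝ) 1).contractibleSpace ⟨0, by simp⟩
    infer_instance
  let I01 : Path (0 : unitInterval) 1 := ⟨ContinuousMap.id _, rfl, rfl⟩
  let p' : Path ((0, 0) : unitInterval × unitInterval) (0, 1) := (Path.refl 0).prod I01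
  let q' : Path ((1, 0) : unitInterval × unitInterval) (1, 1) := (Path.refl 1).prod I01
  let f : Path ((0, 0) : unitInterval × unitInterval) (1, 0) := I01.prod (Path.refl 0)
  let f' : Path ((0, 1) : unitInterval × unitInterval) (1, 1) := I01.prod (Path.refl 1)
  refine homotopic_of_simplyConnected H (p'.trans f') (f.trans q') _ _ ?_ ?_
  · intro t
    rw [Path.trans_apply, Path.trans_apply]
    split_ifs
    · exact (hp _).symm
    · exact (hg' _).symm
  · intro t
    rw [Path.trans_apply, Path.trans_apply]
    split_ifs
    · exact (hg _).symm
    · exact (hq _).symm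

/-- Two paths joined by a homotopy fixing the end points. -/
theorem homotopic_of_rel (H : C(unitInterval × unitInterval, X)) {a b : X} (p q : Path a b)
    (hp : ∀ t, H (0, t) = p t) (hq : ∀ t, H (1, t) = q t)
    (h0 : ∀ s, H (s, 0) = a) (h1 : ∀ s, H (s, 1) = b) : p.Homotopic q :=
  ⟨{ toContinuousMap := H
     map_zero_left := hp
     map_one_left := hq
     prop' := by
      intro t x hx
      rcases hx with rfl | rfl
      · exact (h0 t).trans p.source.symm
      · exact (h1 t).trans p.target.symm }⟩

/-- The class of a loop in the fundamental group. -/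
def loopClass {x : X} (p : Path x x) : FundamentalGroup X x :=
  FundamentalGroup.fromPath (Path.Homotopic.Quotient.mk p)

/-- In a product the right factor is run first. The word of the main theorem is a palindrome and
does not feel this convention, but identities such as $\delta=\sigma_2\sigma_1$ do. -/
theorem loopClass_mul {x : X} (p q : Path x x) :
    loopClass p * loopClass q = loopClass (q.trans p) := rfl

theorem loopClass_eq {x : X} {p q : Path x x} (h : p.Homotopic q) : loopClass p = loopClass q :=
  congrArg FundamentalGroup.fromPath (Path.Homotopic.Quotient.eq.2 h)

/-- Two loops joined by a free homotopy correspond to each other under the change of base point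
along the path traced by the base point. -/
theorem conj_loopClass {x y : X} (g : Path x y) (p : Path x x) (q : Path y y)
    (h : (p.trans g).Homotopic (g.trans q)) :
    FundamentalGroup.fundamentalGroupMulEquivOfPath g (loopClass p) = loopClass q := by
  have e : ((Path.Homotopic.Quotient.mk p).trans (.mk g) : Path.Homotopic.Quotient x y) =
      (Path.Homotopic.Quotient.mk g).trans (.mk q) := Path.Homotopic.Quotient.eq.2 h
  change ((Path.Homotopic.Quotient.mk g).symm.trans ((Path.Homotopic.Quotient.mk p).trans (.mk g)) :
    Path.Homotopic.Quotient y y) = .mk q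
  rw [e, ← Path.Homotopic.Quotient.trans_assoc, Path.Homotopic.Quotient.symm_trans,
    Path.Homotopic.Quotient.refl_trans]

end Homotopy

/-! ### Loops coming from the periods of a map -/

section Periods

variable {X : Type*} [TopologicalSpace X] {E : Type*} [NormedAddCommGroup E] [NormedSpace ℝ E]
  {A : Type*} [AddCommGroup A] (ψ : C(E, X)) (f : A →+ E)
  (hψ : ∀ v a, ψ (v + f a) = ψ v)

/-- The straight path from `v` to `w`. -/
def straightPath (v w : E) : Path v w where
  toFun t := v + (t : ℝ) • (w - v)
  source' := by simp
  target' := by simp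

variable {x : X} (hx : ψ 0 = x)

/-- The loop given by a period `a` of the map `ψ`. -/
def periodLoop (a : A) : Path x x where
  toFun t := ψ ((t : ℝ) • f a)
  source' := by simpa using hx
  target' := by simpa using (hψ 0 a).trans (by simpa using hx)

/-- Since `E` is simply connected, only the end point of a lift matters, so a lift may be replaced
by the straight one. -/
theorem loopClass_eq_periodLoop (a : A) (p : Path 0 (f a)) (γ : Path x x)
    (h : ∀ t, γ t = ψ (p t)) : loopClass γ = loopClass (periodLoop ψ f hψ hx a) :=
  loopClass_eq <| homotopic_of_simplyConnected ψ p (straightPath 0 (f a)) _ _ h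
    fun t => by simp [periodLoop, straightPath]

/-- The homomorphism from the periods of `ψ` to the fundamental group. -/
def periodHom : Multiplicative A →* FundamentalGroup X x :=
  MonoidHom.mk' (fun a => loopClass (periodLoop ψ f hψ hx a.toAdd)) <| by
    intro a b
    rw [loopClass_mul]
    symm
    have e : b.toAdd + a.toAdd = (a * b).toAdd := by simp [add_comm]
    rw [← e]
    -- The product lifts to the broken path through `f b`. Its second leg is a translate by a
    -- period, so `ψ` maps it to the loop of `a`.
    refine loopClass_eq_periodLoop ψ f hψ hx _
      (((straightPath 0 (f b.toAdd)).trans (straightPath (f b.toAdd)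
        (f (b.toAdd + a.toAdd))))) _ fun t => ?_
    rw [Path.trans_apply, Path.trans_apply]
    split_ifs
    · simp [periodLoop, straightPath]
    · simp only [periodLoop, straightPath, map_add, add_sub_cancel_left]
      exact ((congrArg ψ (add_comm _ _)).trans (hψ _ _)).symm

theorem loopClass_eq_periodHom (a : A) (γ : Path x x)
    (h : ∀ t : unitInterval, γ t = ψ ((t : ℝ) • f a)) :
    loopClass γ = periodHom ψ f hψ hx (Multiplicative.ofAdd a) :=
  congrArg loopClass (Path.ext (funext h))

end Periods

/-! ### Half-twists in moving configurations -/

section Moving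

variable {D : Set ℂ} {n : ℕ}

theorem Conf.pt_toUConf (z : Conf D n) (h : StrictMono fun i => lexKey (z.1 i)) (i : Fin n) :
    z.toUConf.pt i = z.1 i := by
  apply lexKey_injective
  rw [UConf.lexKey_pt]
  refine (congrFun (Finset.orderEmbOfFin_unique z.toUConf.card_keys (f := fun i => lexKey (z.1 i))
    (fun x => ?_) h) i).symm
  simp only [UConf.keys, Set.Finite.mem_toFinset]
  exact ⟨_, ⟨x, rfl⟩, rfl⟩

theorem continuous_toUConf_mk {Y : Type*} [TopologicalSpace Y] {z : Y → Fin n → ℂ}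
    (hz : ∀ i, Continuous fun y => z y i) (h : ∀ y, Function.Injective (z y) ∧ ∀ i, z y i ∈ D) :
    Continuous fun y => Conf.toUConf (⟨z y, h y⟩ : Conf D n) :=
  Conf.continuous_toUConf.comp ((continuous_pi hz).subtype_mk h)

/-- The loop of a half-twist. -/
def twistPath {K : UConf D n} {p q : ℂ} {ε : ℝ} (h : IsThin K p q ε) : Path K K :=
  strandPath (twistStrands K h) (twistStrands_zero K h) (twistStrands_one K h)

theorem twistPath_apply {K : UConf D n} {p q : ℂ} {ε : ℝ} (h : IsThin K p q ε) (t : unitInterval) :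
    (twistPath h t).1 = twistMotion p q ε t '' K.1 := by
  change Set.range (twistMotion p q ε t ∘ K.pt) = _
  rw [Set.range_comp, K.range_pt]

/-- Lowering `ε` squeezes the ellipse towards its axis: the image of `u` in the thinner disc is the
image of `Re u + i (ε'/ε) Im u` in the thicker one. The ends of the axis stay in place. -/
theorem IsThin.mono {K : UConf D n} {p q : ℂ} {ε ε' : ℝ} (h : IsThin K p q ε) (h0 : 0 < ε')
    (hle : ε' ≤ ε) : IsThin K p q ε' := by
  have hp : ∀ ε, ellipseMap p q ε (-1) = p := fun ε => by simp [ellipseMap]; ring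
  have hq : ∀ ε, ellipseMap p q ε 1 = q := fun ε => by simp [ellipseMap]; ring
  have hsub : ellipse p q ε' ⊆ ellipse p q ε := by
    rintro _ ⟨u, hu, rfl⟩
    refine ⟨⟨u.re, ε' / ε * u.im⟩, ?_, ?_⟩
    · rw [mem_closedBall_zero_iff] at hu ⊢
      refine le_trans ?_ hu
      rw [Complex.norm_eq_sqrt_sq_add_sq, Complex.norm_eq_sqrt_sq_add_sq]
      apply Real.sqrt_le_sqrt
      have h1 : ε' / ε ≤ 1 := (div_le_one h.2.1).2 hle
      have h2 : 0 ≤ ε' / ε := (div_pos h0 h.2.1).le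
      have h3 : (ε' / ε) ^ 2 ≤ 1 := pow_le_one₀ h2 h1
      simp only [mul_pow]
      nlinarith [sq_nonneg u.im]
    · have : ε * (ε' / ε * u.im) = ε' * u.im := by field_simp [h.2.1.ne']
      simp only [ellipseMap, this]
  refine ⟨h.1, h0, hsub.trans h.2.2.1, ?_⟩
  refine Set.Subset.antisymm ?_ ?_
  · rw [← h.2.2.2]
    exact Set.inter_subset_inter_right _ hsub
  · have hK : {p, q} ⊆ K.1 := h.2.2.2 ▸ Set.inter_subset_left
    rintro x (rfl | rfl)
    · exact ⟨hK (by simp), -1, by simp, hp _⟩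
    · exact ⟨hK (by simp), 1, by simp, hq _⟩

/-- The cases of `twistMotion` compare moving points. As the points stay distinct, they reduce to
comparisons of indices, which do not depend on the parameter; this makes the family continuous. -/
theorem exists_twist_square (z : C(unitInterval, Conf D n)) (i j : Fin n) (ε : C(unitInterval, ℝ))
    (h : ∀ s, IsThin (z s).toUConf ((z s).1 i) ((z s).1 j) (ε s)) :
    ∃ H : C(unitInterval × unitInterval, UConf D n),
      ∀ s t, (H (s, t)) = twistPath (h s) t := by
  have hz : ∀ k, Continuous fun s => (z s).1 k := fun k =>
    (continuous_apply k).comp (continuous_subtype_val.comp z.continuous)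
  have hc : ∀ k, Continuous fun y : unitInterval × unitInterval =>
      twistMotion ((z y.1).1 i) ((z y.1).1 j) (ε y.1) y.2 ((z y.1).1 k) := by
    intro k
    have hzi := (hz i).comp (continuous_fst (X := unitInterval) (Y := unitInterval))
    have hzj := (hz j).comp (continuous_fst (X := unitInterval) (Y := unitInterval))
    have hzk := (hz k).comp (continuous_fst (X := unitInterval) (Y := unitInterval))
    simp only [Function.comp_def] at hzi hzj hzk
    unfold twistMotion ellipseMap
    simp only [(z _).2.1.eq_iff]
    split_ifs <;> fun_prop
  refine ⟨⟨_, continuous_toUConf_mk hc fun y => ⟨fun k l hkl => (z y.1).2.1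
    ((h y.1).twist_injOn y.2 ⟨k, rfl⟩ ⟨l, rfl⟩ hkl), fun k => (h y.1).twist_mem y.2 ⟨k, rfl⟩⟩⟩,
    fun s t => Subtype.ext ?_⟩
  rw [twistPath_apply]
  exact Set.range_comp (twistMotion ((z s).1 i) ((z s).1 j) (ε s) t) (z s).1

theorem exists_conf_eq (K : UConf D n) : ∃ z : Conf D n, z.toUConf = K :=
  ⟨⟨K.pt, K.pt_injective, fun i => K.2.1 (K.range_pt ▸ Set.mem_range_self i)⟩,
    Subtype.ext K.range_pt⟩

/-- The half-twist does not depend on the thin neighbourhood. -/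
theorem halfTwist_eq {K : UConf D n} {p q : ℂ} {ε : ℝ} (h : IsThin K p q ε) :
    halfTwist K p q = loopClass (twistPath h) := by
  have hex : ∃ ε, IsThin K p q ε := ⟨ε, h⟩
  rw [halfTwist, dif_pos hex]
  change loopClass (twistPath hex.choose_spec) = _
  generalize hex.choose_spec = h'
  revert h'
  generalize hex.choose = ε'
  intro h'
  obtain ⟨z, rfl⟩ := exists_conf_eq K
  have hp : p ∈ z.toUConf.1 := (h.2.2.2.ge (mem_insert p {q})).1
  have hq : q ∈ z.toUConf.1 :=  (h.2.2.2.ge (mem_insert_of_mem p rfl)).1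
  obtain ⟨i, rfl⟩ := hp
  obtain ⟨j, rfl⟩ := hq
  -- The larger width is thin, so every width between the two is thin and they can be joined
  -- linearly.
  have hmin : IsThin z.toUConf (z.1 i) (z.1 j) (max ε ε') := by
    rcases le_total ε ε' with hl | hl
    · rwa [max_eq_right hl]
    · rwa [max_eq_left hl]
  have hall : ∀ s : unitInterval, IsThin z.toUConf (z.1 i) (z.1 j) (ε' + (s : ℝ) * (ε - ε')) := by
    intro s
    have h0 := s.2.1
    have h1 := s.2.2
    refine hmin.mono ?_ ?_
    · rcases le_total ε ε' with hl | hl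
      · nlinarith [h.2.1]
      · nlinarith [h'.2.1]
    · rcases le_total ε ε' with hl | hl
      · rw [max_eq_right hl]; nlinarith
      · rw [max_eq_left hl]; nlinarith
  obtain ⟨H, hH⟩ := exists_twist_square (ContinuousMap.const _ z) i j
    ⟨fun s : unitInterval => ε' + (s : ℝ) * (ε - ε'), by fun_prop⟩ hall
  refine loopClass_eq (homotopic_of_rel H _ _ (fun t => ?_) (fun t => ?_) (fun s => ?_)
    fun s => ?_)
  · rw [hH]
    refine Subtype.ext ((twistPath_apply _ t).trans (Eq.trans ?_ (twistPath_apply _ t).symm))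
    simp
  · rw [hH]
    refine Subtype.ext ((twistPath_apply _ t).trans (Eq.trans ?_ (twistPath_apply _ t).symm))
    simp
  · rw [hH, Path.source]; rfl
  · rw [hH, Path.target]; rfl

/-- Half-twists are carried along moving configurations. -/
theorem halfTwist_transport {K L : UConf D n} (g : Path K L) (z : C(unitInterval, Conf D n))
    (hg : ∀ s, (z s).toUConf = g s) (i j : Fin n) {ε : ℝ}
    (h : ∀ s, IsThin (z s).toUConf ((z s).1 i) ((z s).1 j) ε) {p q p' q' : ℂ}
    (hp : (z 0).1 i = p) (hq : (z 0).1 j = q) (hp' : (z 1).1 i = p') (hq' : (z 1).1 j = q') :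
    FundamentalGroup.fundamentalGroupMulEquivOfPath g (halfTwist K p q) = halfTwist L p' q' := by
  have hK : (z 0).toUConf = K := (hg 0).trans g.source
  have hL : (z 1).toUConf = L := (hg 1).trans g.target
  subst hK hL hp hq hp' hq'
  rw [halfTwist_eq (h 0), halfTwist_eq (h 1)]
  obtain ⟨H, hH⟩ := exists_twist_square z i j (ContinuousMap.const _ ε) h
  refine conj_loopClass _ _ _ (homotopic_of_square H _ _ _ _ (fun t => hH _ _) (fun t => hH _ _)
    (fun s => ?_) fun s => ?_)
  · rw [hH, Path.source]; exact hg s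
  · rw [hH, Path.target]; exact hg s

/-- If the segment joining two points of a compact family of configurations meets no other point,
then a single `ε` gives thin neighbourhoods for the whole family. -/
theorem exists_isThin_uniform {Y : Type*} [TopologicalSpace Y] [CompactSpace Y]
    (z : C(Y, Conf D n)) {P η : ℝ} (hη : 0 < η) (hD : Metric.closedBall 0 (P + η) ⊆ D)
    (hz : ∀ y k, ‖(z y).1 k‖ ≤ P) {i j : Fin n} (hij : i ≠ j)
    (hseg : ∀ y k, k ≠ i → k ≠ j → (z y).1 k ∉ segment ℝ ((z y).1 i) ((z y).1 j)) :
    ∃ ε₀ > 0, ∀ ε, 0 < ε → ε ≤ ε₀ → ∀ y, IsThin (z y).toUConf ((z y).1 i) ((z y).1 j) ε := by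
  have hc : ∀ k, Continuous fun s => (z s).1 k := fun k =>
    (continuous_apply k).comp (continuous_subtype_val.comp z.continuous)
  have hd : ∀ k, ∃ d > 0, ∀ y, k ≠ i → k ≠ j → ∀ t ∈ Icc (0 : ℝ) 1,
      d ≤ ‖(z y).1 k - AffineMap.lineMap ((z y).1 i) ((z y).1 j) t‖ := by
    intro k
    by_cases hk : k ≠ i ∧ k ≠ j
    · have hcont : Continuous fun x : Y × unitInterval =>
          ‖(z x.1).1 k - AffineMap.lineMap ((z x.1).1 i) ((z x.1).1 j) (x.2 : ℝ)‖ := by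
        have h1 := (hc i).comp (continuous_fst (X := Y) (Y := unitInterval))
        have h2 := (hc j).comp (continuous_fst (X := Y) (Y := unitInterval))
        have h3 := (hc k).comp (continuous_fst (X := Y) (Y := unitInterval))
        simp only [Function.comp_def] at h1 h2 h3
        simp only [AffineMap.lineMap_apply_module]
        fun_prop
      obtain ⟨d, hd, hd'⟩ := isCompact_univ.exists_forall_le' hcont.continuousOn
        (a := 0) (fun x _ => norm_pos_iff.2 <| sub_ne_zero.2 fun he =>
          hseg x.1 k hk.1 hk.2 (he ▸ by
            rw [segment_eq_image_lineMap]; exact ⟨_, x.2.2, rfl⟩))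
      exact ⟨d, hd, fun y _ _ t ht => hd' (y, ⟨t, ht⟩) (mem_univ _)⟩
    -- For the end points of the segment nothing is required; 1 is a dummy value that lets the
    -- minimum over all indices be taken.
    · exact ⟨1, one_pos, fun y h1 h2 => absurd ⟨h1, h2⟩ hk⟩
  choose d hd0 hd using hd
  have hne : (Finset.univ : Finset (Fin n)).Nonempty := ⟨i, Finset.mem_univ _⟩
  set d₀ := Finset.univ.inf' hne d with hd₀
  have hd₀0 : 0 < d₀ := (Finset.lt_inf'_iff _).2 fun k _ => hd0 k
  set m := min d₀ η with hm
  have hm0 : 0 < m := lt_min hd₀0 hη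
  -- A point of the ellipse is within `ε ‖q - p‖ / 2 ≤ ε |P|` of the segment, and this bound makes
  -- that distance less than `m`. The ellipse then misses the other points (`m ≤ d₀`) and stays in
  -- `D` (`m ≤ η`).
  refine ⟨m / (2 * (|P| + 1)), by positivity, fun ε hε hle y => ?_⟩
  have hne' : (z y).1 i ≠ (z y).1 j := fun h => hij ((z y).2.1 h)
  set p := (z y).1 i with hp
  set q := (z y).1 j with hq
  have key : ∀ u ∈ Metric.closedBall (0 : ℂ) 1, ∃ t ∈ Icc (0 : ℝ) 1,
      ‖ellipseMap p q ε u - AffineMap.lineMap p q t‖ < m := by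
    intro u hu
    rw [mem_closedBall_zero_iff] at hu
    have hre := abs_le.1 ((Complex.abs_re_le_norm u).trans hu)
    have him := (Complex.abs_im_le_norm u).trans hu
    refine ⟨(1 + u.re) / 2, ⟨by linarith [hre.1], by linarith [hre.2]⟩, ?_⟩
    have e : ellipseMap p q ε u - AffineMap.lineMap p q ((1 + u.re) / 2) =
        (q - p) / 2 * ((ε * u.im : ℝ) * Complex.I) := by
      rw [AffineMap.lineMap_apply_module']
      simp only [ellipseMap, Complex.real_smul]
      push_cast
      ring
    rw [e, norm_mul, norm_mul, Complex.norm_I, mul_one, Complex.norm_real, Real.norm_eq_abs,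
      abs_mul, abs_of_pos hε, norm_div, Complex.norm_ofNat]
    have h1 : ‖q - p‖ / 2 ≤ |P| := by
      have := norm_sub_le q p
      have := hz y i
      have := hz y j
      have := le_abs_self P
      linarith
    have h2 : ε * |u.im| ≤ m / (2 * (|P| + 1)) := by
      calc ε * |u.im| ≤ ε * 1 := by gcongr
        _ ≤ _ := by linarith
    calc ‖q - p‖ / 2 * (ε * |u.im|) ≤ |P| * (m / (2 * (|P| + 1))) := by
          gcongr
      _ < m := by
        rw [mul_div_assoc', div_lt_iff₀ (by positivity)]
        nlinarith [abs_nonneg P]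
  refine ⟨hne', hε, ?_, ?_⟩
  · rintro _ ⟨u, hu, rfl⟩
    obtain ⟨t, ht, h⟩ := key u hu
    apply hD
    rw [mem_closedBall_zero_iff]
    have h3 : AffineMap.lineMap p q t ∈ Metric.closedBall (0 : ℂ) P := by
      refine (convex_closedBall (0 : ℂ) P).segment_subset (x := p) (y := q) ?_ ?_ ?_
      · rw [mem_closedBall_zero_iff]; exact hz y i
      · rw [mem_closedBall_zero_iff]; exact hz y j
      · rw [segment_eq_image_lineMap]; exact ⟨_, ht, rfl⟩
    rw [mem_closedBall_zero_iff] at h3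
    have h4 := norm_le_insert' (ellipseMap p q ε u) (AffineMap.lineMap p q t)
    have : m ≤ η := min_le_right _ _
    linarith
  · apply Set.Subset.antisymm
    · rintro _ ⟨⟨k, rfl⟩, u, hu, huk⟩
      by_contra hcon
      simp only [mem_insert_iff, mem_singleton_iff, not_or] at hcon
      obtain ⟨t, ht, h⟩ := key u hu
      have := hd k y (fun h => hcon.1 (h ▸ rfl)) (fun h => hcon.2 (h ▸ rfl)) t ht
      rw [huk] at h
      have h5 : d₀ ≤ d k := Finset.inf'_le _ (Finset.mem_univ k)
      have h6 : m ≤ d₀ := min_le_left _ _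
      linarith
    · rintro x (rfl | rfl)
      · exact ⟨⟨i, rfl⟩, -1, by simp, by simp [ellipseMap]; ring⟩
      · exact ⟨⟨j, rfl⟩, 1, by simp, by simp [ellipseMap]; ring⟩

end Moving

/-! ### Half-twists given by other motions -/

section Recognition

/-- Three strands realise the half-twist exchanging two of their starting points if, seen
from the third point, the strand starting at the second point passes behind the one starting at
the first point. -/
theorem halfTwist_eq_of_strands {D : Set ℂ} (hD : Convex ℝ D) {i j k : Fin 3} (hij : i ≠ j)
    (hik : i ≠ k) (hjk : j ≠ k) {z : Conf D 3} {s : unitInterval → Fin 3 → ℂ}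
    (hs : ∀ m, Continuous fun t => s t m) (hsD : ∀ t m, s t m ∈ D)
    (γ : Path z.toUConf z.toUConf) (hγ : ∀ t, (γ t).1 = Set.range (s t)) (h0 : s 0 = z.1)
    (hi1 : s 1 i = z.1 j) (hj1 : s 1 j = z.1 i) (hk : ∀ t, s t k = z.1 k)
    (l : ℂ →L[ℝ] ℝ) (hl : l (z.1 i) = l (z.1 j)) (hpos : 0 < l (Complex.I * (z.1 j - z.1 i)))
    (hlt : ∀ t, t ≠ 0 → t ≠ 1 → l (s t i) < l (s t j))
    (hki : ∀ t, l (z.1 k) < l (s t i)) (hkj : ∀ t, l (z.1 k) < l (s t j))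
    (hthin : ∃ ε₀ > 0, ∀ ε, 0 < ε → ε ≤ ε₀ → IsThin z.toUConf (z.1 i) (z.1 j) ε) :
    halfTwist z.toUConf (z.1 i) (z.1 j) = loopClass γ := by
  obtain ⟨ε₀, hε₀, hthin⟩ := hthin
  set c := l (Complex.I * (z.1 j - z.1 i)) with hc
  have hki0 : 0 < l (z.1 i) - l (z.1 k) := by
    have := hki 0
    rw [h0] at this
    linarith
  -- In the standard half-twist the strand from `i` dips by at most `ε c / 2` in the direction of
  -- `l`; this choice keeps it above the third point.
  obtain ⟨ε, hε, hεle, hεc⟩ : ∃ ε > 0, ε ≤ ε₀ ∧ ε * c < l (z.1 i) - l (z.1 k) := by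
    refine ⟨min ε₀ ((l (z.1 i) - l (z.1 k)) / (2 * c)), by positivity, min_le_left _ _, ?_⟩
    have h1 : min ε₀ ((l (z.1 i) - l (z.1 k)) / (2 * c)) * c ≤
        (l (z.1 i) - l (z.1 k)) / (2 * c) * c := by gcongr; exact min_le_right _ _
    have h2 : (l (z.1 i) - l (z.1 k)) / (2 * c) * c = (l (z.1 i) - l (z.1 k)) / 2 := by
      field_simp
    linarith
  have ht := hthin ε hε hεle
  rw [halfTwist_eq ht]
  set τ : unitInterval → Fin 3 → ℂ := fun t m => twistMotion (z.1 i) (z.1 j) ε t (z.1 m) with hτ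
  have hlin : ∀ u v : ℝ, l ((z.1 j - z.1 i) / 2 * ((u : ℂ) + (v : ℝ) * Complex.I)) = v * c / 2 := by
    intro u v
    have e : (z.1 j - z.1 i) / 2 * ((u : ℂ) + (v : ℝ) * Complex.I) =
        (u / 2) • (z.1 j - z.1 i) + (v / 2) • (Complex.I * (z.1 j - z.1 i)) := by
      simp only [Complex.real_smul]
      push_cast
      ring
    rw [e, map_add, map_smul, map_smul, map_sub, hl, sub_self, ← hc]
    simp only [smul_eq_mul]
    ring
  have hmid : l ((z.1 i + z.1 j) / 2) = l (z.1 i) := by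
    have e : (z.1 i + z.1 j) / 2 = (1 / 2 : ℝ) • (z.1 i + z.1 j) := by
      simp only [Complex.real_smul]; push_cast; ring
    rw [e, map_smul, map_add, ← hl, smul_eq_mul]
    ring
  have hexp : ∀ t : unitInterval, (Complex.exp (Real.pi * (t : ℝ) * Complex.I)).im =
      Real.sin (Real.pi * t) := by
    intro t
    have := Complex.exp_ofReal_mul_I_im (Real.pi * t)
    push_cast at this
    exact this
  have hτi : ∀ t, l (τ t i) = l (z.1 i) - ε * Real.sin (Real.pi * t) * c / 2 := by
    intro t
    simp only [hτ, twistMotion, if_true, ellipseMap]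
    rw [map_add, hlin, hmid, Complex.neg_im, hexp]
    ring
  have hτj : ∀ t, l (τ t j) = l (z.1 i) + ε * Real.sin (Real.pi * t) * c / 2 := by
    intro t
    simp only [hτ, twistMotion, if_neg (fun h => hij (z.2.1 h).symm), if_true, ellipseMap]
    rw [map_add, hlin, hmid, hexp]
  have hτk : ∀ t, τ t k = z.1 k := by
    intro t
    simp only [hτ, twistMotion, if_neg (fun h => hik (z.2.1 h).symm),
      if_neg (fun h => hjk (z.2.1 h).symm)]
  have hsin0 : ∀ t : unitInterval, 0 ≤ Real.sin (Real.pi * t) := fun t =>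
    Real.sin_nonneg_of_nonneg_of_le_pi (mul_nonneg Real.pi_pos.le t.2.1)
      (mul_le_of_le_one_right Real.pi_pos.le t.2.2)
  have hsin : ∀ t : unitInterval, t ≠ 0 → t ≠ 1 → 0 < Real.sin (Real.pi * t) := fun t h h' =>
    Real.sin_pos_of_pos_of_lt_pi (mul_pos Real.pi_pos (unitInterval.pos_iff_ne_zero.2 h))
      (mul_lt_of_lt_one_right Real.pi_pos (unitInterval.lt_one_iff_ne_one.2 h'))
  have hτ0 : ∀ m, τ 0 m = z.1 m := by
    intro m
    simp only [hτ, twistMotion, ellipseMap]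
    split_ifs with h1 h2
    · rw [h1]; simp; ring
    · rw [h2]; simp; ring
    · rfl
  have hτ1i : τ 1 i = z.1 j := by
    simp only [hτ, twistMotion, if_true, ellipseMap]
    simp [Complex.exp_pi_mul_I]; ring
  have hτ1j : τ 1 j = z.1 i := by
    simp only [hτ, twistMotion, if_neg (fun h => hij (z.2.1 h).symm), if_true, ellipseMap]
    simp [Complex.exp_pi_mul_I]; ring
  have hcases : ∀ m : Fin 3, m = i ∨ m = j ∨ m = k := by
    revert hij hik hjk
    clear * -
    revert i j k
    decide
  -- The straight-line homotopy from the standard half-twist to the given strands. Both motions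
  -- satisfy the same strict inequalities between values of `l`, and these survive convex
  -- combinations, so strands never collide. At the two end times, where `i` and `j` have equal `l`,
  -- the configuration is constant in the homotopy parameter.
  set h : unitInterval × unitInterval → Fin 3 → ℂ := fun y m =>
    (1 - (y.1 : ℝ)) • τ y.2 m + (y.1 : ℝ) • s y.2 m with hh
  have hlc : ∀ (a x y x' y' : ℝ), 0 ≤ a → a ≤ 1 → x < y → x' < y' →
      (1 - a) * x + a * x' < (1 - a) * y + a * y' := by
    intro a x y x' y' h0 h1 h2 h3
    rcases h0.eq_or_lt with rfl | h0
    · simpa using h2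
    · have := mul_le_mul_of_nonneg_left h2.le (sub_nonneg.2 h1)
      have := mul_lt_mul_of_pos_left h3 h0
      linarith
  have hlh : ∀ y m, l (h y m) = (1 - (y.1 : ℝ)) * l (τ y.2 m) + (y.1 : ℝ) * l (s y.2 m) := by
    intro y m
    simp only [hh, map_add, map_smul, smul_eq_mul]
  have hsinle : ∀ t : unitInterval, ε * Real.sin (Real.pi * t) * c / 2 < l (z.1 i) - l (z.1 k) := by
    intro t
    have h1 : ε * Real.sin (Real.pi * t) * c ≤ ε * 1 * c := by
      gcongr
      exact Real.sin_le_one _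
    have h2 : 0 < ε * c := mul_pos hε hpos
    linarith
  have hsinge : ∀ t : unitInterval, 0 ≤ ε * Real.sin (Real.pi * t) * c / 2 := by
    intro t
    have := hsin0 t
    positivity
  have hdik : ∀ y, l (h y k) < l (h y i) := fun y => by
    rw [hlh, hlh]
    refine hlc _ _ _ _ _ y.1.2.1 y.1.2.2 ?_ ?_
    · rw [hτk, hτi]; linarith [hsinle y.2]
    · rw [hk]; exact hki _
  have hdjk : ∀ y, l (h y k) < l (h y j) := fun y => by
    rw [hlh, hlh]
    refine hlc _ _ _ _ _ y.1.2.1 y.1.2.2 ?_ ?_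
    · rw [hτk, hτj]; linarith [hsinge y.2]
    · rw [hk]; exact hkj _
  have h_0 : ∀ a m, h (a, 0) m = z.1 m := by
    intro a m
    simp only [hh, hτ0, h0, ← add_smul]
    simp
  have h_1i : ∀ a, h (a, 1) i = z.1 j := by
    intro a
    simp only [hh, hτ1i, hi1, ← add_smul]
    simp
  have h_1j : ∀ a, h (a, 1) j = z.1 i := by
    intro a
    simp only [hh, hτ1j, hj1, ← add_smul]
    simp
  have h_k : ∀ y, h y k = z.1 k := by
    intro y
    simp only [hh, hτk, hk, ← add_smul]
    simp
  have hdij : ∀ y, h y i ≠ h y j := by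
    rintro ⟨a, t⟩
    by_cases ht0 : t = 0
    · subst ht0
      rw [h_0, h_0]
      exact fun h => hij (z.2.1 h)
    by_cases ht1 : t = 1
    · subst ht1
      rw [h_1i, h_1j]
      exact fun h => hij (z.2.1 h).symm
    · refine fun h => (?_ : l _ < l _).ne (congrArg l h)
      rw [hlh, hlh]
      refine hlc _ _ _ _ _ a.2.1 a.2.2 ?_ (hlt t ht0 ht1)
      have : 0 < ε * Real.sin (Real.pi * t) * c := mul_pos (mul_pos hε (hsin t ht0 ht1)) hpos
      rw [hτi, hτj]
      linarith
  have hinj : ∀ y, Function.Injective (h y) := by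
    intro y m m' hmm
    have a1 := hdij y
    have a2 : h y i ≠ h y k := fun e => (hdik y).ne (congrArg l e.symm)
    have a3 : h y j ≠ h y k := fun e => (hdjk y).ne (congrArg l e.symm)
    rcases hcases m with rfl | rfl | rfl <;> rcases hcases m' with rfl | rfl | rfl
    exacts [rfl, absurd hmm a1, absurd hmm a2, absurd hmm.symm a1, rfl, absurd hmm a3,
      absurd hmm.symm a2, absurd hmm.symm a3, rfl]
  have hmem : ∀ y m, h y m ∈ D := fun y m =>
    hD (ht.twist_mem _ ⟨m, rfl⟩) (hsD _ _) (sub_nonneg.2 y.1.2.2) y.1.2.1 (by ring)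
  have hcont : ∀ m, Continuous fun y => h y m := by
    intro m
    have c1 : Continuous fun y : unitInterval × unitInterval => τ y.2 m :=
      (continuous_twistMotion _ _ _ _).comp continuous_snd
    have c2 : Continuous fun y : unitInterval × unitInterval => s y.2 m :=
      (hs m).comp continuous_snd
    have c3 : Continuous fun y : unitInterval × unitInterval => (y.1 : ℝ) :=
      continuous_subtype_val.comp continuous_fst
    exact ((continuous_const.sub c3).smul c1).add (c3.smul c2)
  refine loopClass_eq (homotopic_of_rel
    ⟨_, continuous_toUConf_mk hcont fun y => ⟨hinj y, hmem y⟩⟩ _ _ (fun t => ?_) (fun t => ?_)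
    (fun a => ?_) fun a => ?_)
  · refine Subtype.ext (Eq.trans ?_ (twistPath_apply ht t).symm)
    change Set.range (h (0, t)) = _ '' Set.range z.1
    rw [← Set.range_comp]
    congr 1
    ext m
    simp [hh, hτ]
  · refine Subtype.ext (Eq.trans ?_ (hγ t).symm)
    change Set.range (h (1, t)) = Set.range (s t)
    congr 1
    ext m
    simp [hh]
  · refine Subtype.ext ?_
    change Set.range (h (a, 0)) = Set.range z.1
    congr 1
    ext m
    exact h_0 a m
  · refine Subtype.ext ?_
    change Set.range (h (a, 1)) = Set.range z.1
    have e : h (a, 1) = z.1 ∘ Equiv.swap i j := by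
      ext m
      rcases hcases m with rfl | rfl | rfl
      · simp [h_1i]
      · simp [h_1j]
      · simp [h_k, Equiv.swap_apply_of_ne_of_ne hik.symm hjk.symm]
    rw [e, (Equiv.swap i j).surjective.range_comp]

end Recognition

/-! ### Braids of an equilateral triangle -/

section Triangle

/-- The point of the unit circle reached after `x` thirds of a turn. -/
def thirdTurn (x : ℝ) : ℂ := Complex.exp ((2 * Real.pi * x / 3 : ℝ) * Complex.I)

theorem thirdTurn_add (x y : ℝ) : thirdTurn (x + y) = thirdTurn x * thirdTurn y := by
  rw [thirdTurn, thirdTurn, thirdTurn, ← Complex.exp_add]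
  congr 1
  push_cast
  ring

@[simp] theorem thirdTurn_zero : thirdTurn 0 = 1 := by simp [thirdTurn]

@[simp] theorem thirdTurn_three : thirdTurn 3 = 1 := by
  rw [thirdTurn]
  convert Complex.exp_two_pi_mul_I using 2
  push_cast
  ring

@[simp] theorem norm_thirdTurn (x : ℝ) : ‖thirdTurn x‖ = 1 := Complex.norm_exp_ofReal_mul_I _

theorem conj_thirdTurn (x : ℝ) : (starRingEnd ℂ) (thirdTurn x) = thirdTurn (-x) := by
  rw [thirdTurn, thirdTurn, ← Complex.exp_conj]
  congr 1
  rw [map_mul, Complex.conj_I, Complex.conj_ofReal]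
  push_cast
  ring

theorem thirdTurn_re (x : ℝ) : (thirdTurn x).re = Real.cos (2 * Real.pi * x / 3) :=
  Complex.exp_ofReal_mul_I_re _

theorem thirdTurn_im (x : ℝ) : (thirdTurn x).im = Real.sin (2 * Real.pi * x / 3) :=
  Complex.exp_ofReal_mul_I_im _

@[fun_prop] theorem continuous_thirdTurn : Continuous thirdTurn := by
  unfold thirdTurn
  fun_prop

theorem thirdTurn_one : thirdTurn 1 = ⟨-1 / 2, √3 / 2⟩ := by
  have e : 2 * Real.pi * 1 / 3 = Real.pi - Real.pi / 3 := by ring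
  apply Complex.ext
  · rw [thirdTurn_re, e, Real.cos_pi_sub, Real.cos_pi_div_three]; norm_num
  · rw [thirdTurn_im, e, Real.sin_pi_sub, Real.sin_pi_div_three]

theorem thirdTurn_two : thirdTurn 2 = ⟨-1 / 2, -(√3 / 2)⟩ := by
  have e : 2 * Real.pi * 2 / 3 = Real.pi / 3 + Real.pi := by ring
  apply Complex.ext
  · rw [thirdTurn_re, e, Real.cos_add_pi, Real.cos_pi_div_three]; norm_num
  · rw [thirdTurn_im, e, Real.sin_add_pi, Real.sin_pi_div_three]

theorem thirdTurn_ne {u v : ℝ} (h : u < v) (h' : v < u + 3) : thirdTurn u ≠ thirdTurn v := by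
  intro he
  have e1 : thirdTurn (v - u) = 1 := by
    have : thirdTurn u ≠ 0 := Complex.exp_ne_zero _
    apply mul_left_cancel₀ this
    rw [← thirdTurn_add, mul_one, he]
    congr 1
    ring
  have e2 := congrArg Complex.re e1
  rw [thirdTurn_re, Complex.one_re, Real.cos_eq_one_iff_of_lt_of_lt] at e2
  · have := Real.pi_pos
    have : v - u = 0 := by
      by_contra hne
      exact (by positivity : 2 * Real.pi * (v - u) / 3 ≠ 0) e2
    linarith
  · have := Real.pi_pos
    have : 0 < 2 * Real.pi * (v - u) / 3 := by
      have : 0 < v - u := by linarith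
      positivity
    linarith
  · have := Real.pi_pos
    nlinarith

/-- A convex combination of the third roots of unity lies inside the unit circle, except for the
roots themselves. -/
theorem normSq_combo (x y w : ℝ) (h : x + y + w = 1) :
    Complex.normSq (x * thirdTurn 2 + y * thirdTurn 1 + w) = 1 - 3 * (x * y + y * w + x * w) := by
  rw [thirdTurn_one, thirdTurn_two, Complex.normSq_apply]
  simp only [Complex.add_re, Complex.mul_re, Complex.ofReal_re, Complex.ofReal_im, Complex.add_im,
    Complex.mul_im]
  have h3 : √3 * √3 = 3 := Real.mul_self_sqrt (by norm_num)
  obtain rfl : w = 1 - x - y := by linarith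
  ring_nf
  rw [show √3 ^ 2 = 3 by rw [sq, h3]]
  ring

variable {D : Set ℂ} {P : ℝ}

theorem mul_mem_of_norm_le (hP : 0 < P) (hD : Metric.closedBall 0 P ⊆ D) {b : ℂ} (hb : ‖b‖ ≤ 1) :
    P * b ∈ D := by
  apply hD
  rw [mem_closedBall_zero_iff, norm_mul, Complex.norm_real, Real.norm_of_nonneg hP.le]
  exact mul_le_of_le_one_right hP.le hb

theorem injective_vec3 {a b c : ℂ} (hab : a ≠ b) (hac : a ≠ c) (hbc : b ≠ c) :
    Function.Injective ![a, b, c] := by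
  intro i j
  fin_cases i <;> fin_cases j <;> simp [hab, hac, hbc, hab.symm, hac.symm, hbc.symm]

theorem range_vec3 (a b c : ℂ) : Set.range ![a, b, c] = {a, b, c} := by
  ext x
  simp only [Matrix.range_cons, Matrix.range_empty, union_empty, mem_union, mem_singleton_iff,
    mem_insert_iff]

/-- The configuration `P b`, `P e^{2πiu/3}`, `P e^{2πiv/3}`. -/
def circleConf (hP : 0 < P) (hD : Metric.closedBall 0 P ⊆ D) (b : ℂ) (u v : ℝ) (hb : ‖b‖ ≤ 1)
    (hbu : b ≠ thirdTurn u) (hbv : b ≠ thirdTurn v) (huv : thirdTurn u ≠ thirdTurn v) :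
    Conf D 3 :=
  ⟨![P * b, P * thirdTurn u, P * thirdTurn v], by
    have hP' : (P : ℂ) ≠ 0 := Complex.ofReal_ne_zero.2 hP.ne'
    refine ⟨injective_vec3 ?_ ?_ ?_, fun i => ?_⟩
    · exact fun h => hbu (mul_left_cancel₀ hP' h)
    · exact fun h => hbv (mul_left_cancel₀ hP' h)
    · exact fun h => huv (mul_left_cancel₀ hP' h)
    · fin_cases i
      · exact mul_mem_of_norm_le hP hD hb
      · exact mul_mem_of_norm_le hP hD (norm_thirdTurn u).le
      · exact mul_mem_of_norm_le hP hD (norm_thirdTurn v).le⟩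

/-- The triangle of the third roots of unity, scaled by `P`. -/
def triangle (hP : 0 < P) (hD : Metric.closedBall 0 P ⊆ D) : Conf D 3 :=
  circleConf hP hD (thirdTurn 2) 1 0 (norm_thirdTurn 2).le
    (thirdTurn_ne (by norm_num) (by norm_num)).symm
    (thirdTurn_ne (by norm_num) (by norm_num)).symm
    (thirdTurn_ne (by norm_num) (by norm_num)).symm

/-- One vertex moves along the chord while the other returns counterclockwise along the arc. Seen
from the opposite vertex the arc lies behind the chord, so `halfTwist_eq_of_strands` applies. The
factor `ζ` allows any side of the triangle to be used. -/
theorem halfTwist_triangle (hDc : Convex ℝ D) (hP : 0 < P) (hD : Metric.closedBall 0 P ⊆ D)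
    {ζ : ℂ} (hζ : ‖ζ‖ = 1) {i j k : Fin 3} (hij : i ≠ j) (hik : i ≠ k) (hjk : j ≠ k)
    {z : Conf D 3} (hzi : z.1 i = P * (ζ * thirdTurn 1)) (hzj : z.1 j = P * ζ)
    (hzk : z.1 k = P * (ζ * thirdTurn 2)) (γ : Path z.toUConf z.toUConf)
    (hγ : ∀ t : unitInterval, (γ t).1 = {P * (ζ * ((1 - (t : ℝ)) * thirdTurn 1 + (t : ℝ))),
      P * (ζ * thirdTurn t), P * (ζ * thirdTurn 2)})
    (hthin : ∃ ε₀ > 0, ∀ ε, 0 < ε → ε ≤ ε₀ → IsThin z.toUConf (z.1 i) (z.1 j) ε) :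
    halfTwist z.toUConf (z.1 i) (z.1 j) = loopClass γ := by
  set s : unitInterval → Fin 3 → ℂ := fun t m =>
    if m = i then P * (ζ * ((1 - (t : ℝ)) * thirdTurn 1 + (t : ℝ)))
    else if m = j then P * (ζ * thirdTurn t) else P * (ζ * thirdTurn 2) with hs
  have hcases : ∀ m : Fin 3, m = i ∨ m = j ∨ m = k := by
    revert hij hik hjk
    clear * -
    revert i j k
    decide
  have hsi : ∀ t, s t i = P * (ζ * ((1 - (t : ℝ)) * thirdTurn 1 + (t : ℝ))) := fun t => if_pos rfl
  have hsj : ∀ t, s t j = P * (ζ * thirdTurn t) := fun t => by simp [hs, hij.symm]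
  have hsk : ∀ t, s t k = P * (ζ * thirdTurn 2) := fun t => by simp [hs, hik.symm, hjk.symm]
  set v : ℂ := ζ * thirdTurn (1 / 2) with hv
  -- The component in the direction `v` of the midpoint of the arc: it is constantly `P / 2` on the
  -- chord, larger inside the arc, and `-P` at the opposite vertex.
  set l : ℂ →L[ℝ] ℝ := Complex.reCLM.comp (ContinuousLinearMap.mul ℝ ℂ (starRingEnd ℂ v)) with hl
  have hζζ : starRingEnd ℂ ζ * ζ = 1 := by
    rw [mul_comm, Complex.mul_conj, Complex.normSq_eq_norm_sq, hζ]; norm_num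
  have hl1 : ∀ y, l (P * (ζ * y)) = P * (thirdTurn (-(1 / 2)) * y).re := by
    intro y
    change (starRingEnd ℂ v * (P * (ζ * y))).re = _
    rw [hv, map_mul, conj_thirdTurn, ← Complex.re_ofReal_mul]
    congr 1
    linear_combination (thirdTurn (-(1 / 2)) * P * y) * hζζ
  have hl2 : ∀ x, l (P * (ζ * thirdTurn x)) = P * Real.cos (2 * Real.pi * (x - 1 / 2) / 3) := by
    intro x
    rw [hl1, ← thirdTurn_add, thirdTurn_re]
    ring_nf
  have hl21 : l (P * (ζ * thirdTurn 1)) = P / 2 := by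
    rw [hl2, show 2 * Real.pi * (1 - 1 / 2) / 3 = Real.pi / 3 by ring, Real.cos_pi_div_three]
    ring
  have hl20 : l (P * ζ) = P / 2 := by
    have := hl2 0
    rw [thirdTurn_zero, mul_one, show 2 * Real.pi * (0 - 1 / 2) / 3 = -(Real.pi / 3) by ring,
      Real.cos_neg, Real.cos_pi_div_three] at this
    rw [this]; ring
  have hl22 : l (P * (ζ * thirdTurn 2)) = -P := by
    rw [hl2, show 2 * Real.pi * (2 - 1 / 2) / 3 = Real.pi by ring, Real.cos_pi]
    ring
  have hli : ∀ t, l (s t i) = P / 2 := by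
    intro t
    have e : (P : ℂ) * (ζ * ((1 - (t : ℝ)) * thirdTurn 1 + (t : ℝ))) =
        (1 - (t : ℝ)) • ((P : ℂ) * (ζ * thirdTurn 1)) + (t : ℝ) • ((P : ℂ) * ζ) := by
      simp only [Complex.real_smul]
      push_cast
      ring
    rw [hsi, e, map_add, map_smul, map_smul, hl21, hl20]
    simp only [smul_eq_mul]
    ring
  have hlj : ∀ t : unitInterval, P / 2 ≤ l (s t j) ∧ (t ≠ 0 → t ≠ 1 → P / 2 < l (s t j)) := by
    intro t
    have ht0 := t.2.1
    have ht1 := t.2.2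
    rw [hsj, hl2]
    have habs : |2 * Real.pi * ((t : ℝ) - 1 / 2) / 3| = 2 * Real.pi / 3 * |(t : ℝ) - 1 / 2| := by
      rw [mul_div_right_comm, abs_mul, abs_of_pos (by positivity)]
    have hle : |(t : ℝ) - 1 / 2| ≤ 1 / 2 := abs_le.2 ⟨by linarith, by linarith⟩
    rw [← Real.cos_abs, habs]
    have h3 := Real.cos_pi_div_three
    have hpi := Real.pi_pos
    constructor
    · have : Real.cos (Real.pi / 3) ≤ Real.cos (2 * Real.pi / 3 * |(t : ℝ) - 1 / 2|) :=
        Real.cos_le_cos_of_nonneg_of_le_pi (by positivity) (by linarith) (by nlinarith)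
      nlinarith
    · intro h0 h1
      have hlt : |(t : ℝ) - 1 / 2| < 1 / 2 := by
        have a : (0 : ℝ) < t := unitInterval.pos_iff_ne_zero.2 h0
        have b : (t : ℝ) < 1 := unitInterval.lt_one_iff_ne_one.2 h1
        exact abs_lt.2 ⟨by linarith, by linarith⟩
      have : Real.cos (Real.pi / 3) < Real.cos (2 * Real.pi / 3 * |(t : ℝ) - 1 / 2|) :=
        Real.cos_lt_cos_of_nonneg_of_le_pi (by positivity) (by linarith) (by nlinarith)
      nlinarith
  have hζm : ∀ b : ℂ, ‖b‖ ≤ 1 → P * (ζ * b) ∈ D := fun b hb =>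
    mul_mem_of_norm_le hP hD (by rw [norm_mul, hζ, one_mul]; exact hb)
  refine halfTwist_eq_of_strands hDc hij hik hjk (s := s) ?_ ?_ γ ?_ ?_ ?_ ?_ ?_ l ?_ ?_ ?_ ?_ ?_
    hthin
  · intro m
    simp only [hs]
    split_ifs <;> fun_prop
  · intro t m
    simp only [hs]
    split_ifs
    · apply hζm
      have := norm_add_le ((1 - ((t : ℝ) : ℂ)) * thirdTurn 1) ((t : ℝ) : ℂ)
      have e : (1 - ((t : ℝ) : ℂ)) = ((1 - t : ℝ) : ℂ) := by push_cast; rfl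
      rw [e] at this ⊢
      rw [norm_mul, norm_thirdTurn, Complex.norm_real, Complex.norm_real,
        Real.norm_of_nonneg t.2.1, Real.norm_of_nonneg (sub_nonneg.2 t.2.2)] at this
      linarith
    · exact hζm _ (norm_thirdTurn _).le
    · exact hζm _ (norm_thirdTurn _).le
  · intro t
    rw [hγ]
    ext x
    constructor
    · rintro (rfl | rfl | rfl)
      exacts [⟨i, hsi t⟩, ⟨j, hsj t⟩, ⟨k, hsk t⟩]
    · rintro ⟨m, rfl⟩
      rcases hcases m with rfl | rfl | rfl
      · exact Or.inl (hsi t)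
      · exact Or.inr (Or.inl (hsj t))
      · exact Or.inr (Or.inr (hsk t))
  · ext m
    rcases hcases m with rfl | rfl | rfl
    · rw [hsi, hzi]; simp
    · rw [hsj, hzj]; simp
    · rw [hsk, hzk]
  · rw [hsi, hzj]; simp
  · rw [hsj, hzi]; simp
  · intro t; rw [hsk, hzk]
  · rw [hzi, hzj, hl21, hl20]
  · rw [hzi, hzj]
    have e : Complex.I * (P * ζ - P * (ζ * thirdTurn 1)) =
        P * (ζ * (Complex.I * (1 - thirdTurn 1))) := by ring
    have e' : thirdTurn (-(1 / 2)) * (Complex.I * (1 - thirdTurn 1)) =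
        Complex.I * (thirdTurn (-(1 / 2)) - thirdTurn (1 / 2)) := by
      have : thirdTurn (-(1 / 2)) * thirdTurn 1 = thirdTurn (1 / 2) := by
        rw [← thirdTurn_add]; norm_num
      linear_combination (-Complex.I) * this
    rw [e, hl1, e', Complex.I_mul_re, Complex.sub_im, thirdTurn_im, thirdTurn_im,
      show 2 * Real.pi * (-(1 / 2)) / 3 = -(Real.pi / 3) by ring,
      show 2 * Real.pi * (1 / 2) / 3 = Real.pi / 3 by ring, Real.sin_neg, Real.sin_pi_div_three]
    have : 0 < √3 := by positivity
    have := mul_pos hP this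
    linarith
  · intro t h0 h1
    rw [hli]
    exact (hlj t).2 h0 h1
  · intro t
    rw [hzk, hl22, hli]
    linarith
  · intro t
    rw [hzk, hl22]
    linarith [(hlj t).1]

end Triangle

/-! ### Rotations of the triangle and the factorisation of a third of a turn -/

section Turn

variable {D : Set ℂ} {P : ℝ}

/-- By strict convexity of the disc, a chord meets the circle only at its ends. -/
theorem not_mem_segment_of_norm {x p q : ℂ} (hp : ‖p‖ = P) (hq : ‖q‖ = P) (hx : ‖x‖ = P)
    (hpq : p ≠ q) (hxp : x ≠ p) (hxq : x ≠ q) : x ∉ segment ℝ p q := by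
  rintro ⟨a, b, ha, hb, hab, rfl⟩
  rcases ha.eq_or_lt with rfl | ha
  · obtain rfl : b = 1 := by linarith
    simp at hxq
  rcases hb.eq_or_lt with rfl | hb
  · obtain rfl : a = 1 := by linarith
    simp at hxp
  have := combo_mem_ball_of_ne (z := (0 : ℂ)) (mem_closedBall_zero_iff.2 hp.le)
    (mem_closedBall_zero_iff.2 hq.le) hpq ha hb hab
  rw [mem_ball_zero_iff] at this
  exact this.ne hx

theorem exists_isThin_circle {n : ℕ} {Y : Type*} [TopologicalSpace Y] [CompactSpace Y]
    (z : C(Y, Conf D n)) {η : ℝ} (hη : 0 < η) (hD : Metric.closedBall 0 (P + η) ⊆ D)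
    (hz : ∀ y k, ‖(z y).1 k‖ = P) {i j : Fin n} (hij : i ≠ j) :
    ∃ ε₀ > 0, ∀ ε, 0 < ε → ε ≤ ε₀ → ∀ y, IsThin (z y).toUConf ((z y).1 i) ((z y).1 j) ε :=
  exists_isThin_uniform z hη hD (fun y k => (hz y k).le) hij fun y k hki hkj =>
    not_mem_segment_of_norm (hz y i) (hz y j) (hz y k) (fun h => hij ((z y).2.1 h))
      (fun h => hki ((z y).2.1 h)) fun h => hkj ((z y).2.1 h)

/-- The triangle turned by `x` thirds of a turn. -/
def turnConf (hP : 0 < P) (hD : Metric.closedBall 0 P ⊆ D) (x : ℝ) : Conf D 3 :=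
  circleConf hP hD (thirdTurn (2 + x)) (1 + x) x (norm_thirdTurn _).le
    (thirdTurn_ne (by linarith) (by linarith)).symm
    (thirdTurn_ne (by linarith) (by linarith)).symm
    (thirdTurn_ne (by linarith) (by linarith)).symm

theorem turnConf_zero (hP : 0 < P) (hD : Metric.closedBall 0 P ⊆ D) :
    turnConf hP hD 0 = triangle hP hD := by
  refine Subtype.ext ?_
  simp [turnConf, triangle, circleConf]

theorem continuous_turnConf (hP : 0 < P) (hD : Metric.closedBall 0 P ⊆ D) :
    Continuous (turnConf hP hD) := by
  refine Continuous.subtype_mk (continuous_pi fun i => ?_) _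
  fin_cases i <;> simp <;> fun_prop

theorem norm_turnConf (hP : 0 < P) (hD : Metric.closedBall 0 P ⊆ D) (x : ℝ) (i : Fin 3) :
    ‖(turnConf hP hD x).1 i‖ = P := by
  fin_cases i <;> simp [turnConf, circleConf, abs_of_pos hP]

theorem norm_triangle (hP : 0 < P) (hD : Metric.closedBall 0 P ⊆ D) (i : Fin 3) :
    ‖(triangle hP hD).1 i‖ = P := by
  rw [← turnConf_zero]
  exact norm_turnConf hP hD 0 i

/-- The family of turned triangles as a map to the unordered configurations. -/
def turnMap (hP : 0 < P) (hD : Metric.closedBall 0 P ⊆ D) : C(ℝ, UConf D 3) :=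
  ⟨_, Conf.continuous_toUConf.comp (continuous_turnConf hP hD)⟩

theorem turnMap_coe (hP : 0 < P) (hD : Metric.closedBall 0 P ⊆ D) (x : ℝ) :
    (turnMap hP hD x).1 = {P * thirdTurn (2 + x), P * thirdTurn (1 + x), P * thirdTurn x} :=
  range_vec3 _ _ _

theorem triangle_coe (hP : 0 < P) (hD : Metric.closedBall 0 P ⊆ D) :
    (triangle hP hD).toUConf.1 = {P * thirdTurn 2, P * thirdTurn 1, P * thirdTurn 0} :=
  range_vec3 _ _ _

theorem turnMap_zero (hP : 0 < P) (hD : Metric.closedBall 0 P ⊆ D) :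
    turnMap hP hD 0 = (triangle hP hD).toUConf :=
  congrArg Conf.toUConf (turnConf_zero hP hD)

/-- A third of a turn permutes the vertices cyclically, so without numbering the period is 1 and not
3. -/
theorem turnMap_add_int (hP : 0 < P) (hD : Metric.closedBall 0 P ⊆ D) (x : ℝ) (n : ℤ) :
    turnMap hP hD (x + Int.castAddHom ℝ n) = turnMap hP hD x := by
  have h : Function.Periodic (turnMap hP hD) 1 := by
    intro x
    refine Subtype.ext ?_
    rw [turnMap_coe, turnMap_coe, show 2 + (x + 1) = 3 + x by ring, thirdTurn_add 3,
      thirdTurn_three, one_mul, show 1 + (x + 1) = 2 + x by ring, add_comm x 1]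
    ext y
    simp only [mem_insert_iff, mem_singleton_iff]
    tauto
  simpa using h.int_mul n x

/-- The homomorphism taking `n` to the turn of the triangle by `n` thirds. -/
def turnHom (hP : 0 < P) (hD : Metric.closedBall 0 P ⊆ D) :
    Multiplicative ℤ →* FundamentalGroup (UConf D 3) (triangle hP hD).toUConf :=
  periodHom (turnMap hP hD) (Int.castAddHom ℝ) (turnMap_add_int hP hD) (turnMap_zero hP hD)

/-- The braid of a third of a turn of the triangle. -/
def thirdTurnPath (hP : 0 < P) (hD : Metric.closedBall 0 P ⊆ D) :
    Path (triangle hP hD).toUConf (triangle hP hD).toUConf :=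
  periodLoop (turnMap hP hD) (Int.castAddHom ℝ) (turnMap_add_int hP hD) (turnMap_zero hP hD) 1

theorem thirdTurnPath_apply (hP : 0 < P) (hD : Metric.closedBall 0 P ⊆ D) (t : unitInterval) :
    thirdTurnPath hP hD t = turnMap hP hD t := by
  change turnMap hP hD ((t : ℝ) • ((1 : ℤ) : ℝ)) = _
  simp

theorem turnHom_eq_pow (hP : 0 < P) (hD : Metric.closedBall 0 P ⊆ D) :
    turnHom hP hD (Multiplicative.ofAdd 3) = loopClass (thirdTurnPath hP hD) ^ 3 := by
  have : (Multiplicative.ofAdd (3 : ℤ)) = Multiplicative.ofAdd 1 ^ 3 := rfl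
  rw [this, map_pow]
  rfl

theorem conj_path_loop {X : Type*} [TopologicalSpace X] {x : X} (g : Path x x)
    (a : FundamentalGroup X x) :
    FundamentalGroup.fundamentalGroupMulEquivOfPath g a =
      loopClass g * a * (loopClass g)⁻¹ := rfl

/-- The rotation carries the side from vertex 1 to vertex 2 onto the side from vertex 0 to vertex 1,
and the half-twist with it. Transport along a loop is conjugation by its class. -/
theorem thirdTurn_conj (hP : 0 < P) (hD : Metric.closedBall 0 P ⊆ D) {η : ℝ} (hη : 0 < η)
    (hD' : Metric.closedBall 0 (P + η) ⊆ D) :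
    loopClass (thirdTurnPath hP hD) *
        halfTwist (triangle hP hD).toUConf ((triangle hP hD).1 1) ((triangle hP hD).1 2) =
      halfTwist (triangle hP hD).toUConf ((triangle hP hD).1 0) ((triangle hP hD).1 1) *
        loopClass (thirdTurnPath hP hD) := by
  let z : C(unitInterval, Conf D 3) := ⟨fun t => turnConf hP hD t,
    (continuous_turnConf hP hD).comp continuous_subtype_val⟩
  obtain ⟨ε, hε, hthin⟩ := exists_isThin_circle z hη hD' (fun y k => norm_turnConf hP hD y k)
    (show (1 : Fin 3) ≠ 2 by decide)
  have h0 : z 0 = triangle hP hD := turnConf_zero hP hD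
  have e2 : (1 : ℝ) + 1 = 2 := by norm_num
  have h := halfTwist_transport (thirdTurnPath hP hD) z
    (fun s => (thirdTurnPath_apply hP hD s).symm) 1 2 (hthin ε hε le_rfl)
    (p' := (triangle hP hD).1 0) (q' := (triangle hP hD).1 1)
    (congrArg (fun c => c.1 1) h0) (congrArg (fun c => c.1 2) h0)
    (by simp [z, turnConf, triangle, circleConf, e2]) (by simp [z, turnConf, triangle, circleConf])
  rw [conj_path_loop, mul_inv_eq_iff_eq_mul] at h
  exact h

/-- The pairs `(u, v)` with `0 ≤ v ≤ u ≤ 1`. -/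
def simplex : Set (ℝ × ℝ) := {x | 0 ≤ x.2 ∧ x.2 ≤ x.1 ∧ x.1 ≤ 1}

theorem convex_simplex : Convex ℝ simplex := by
  rintro ⟨u, v⟩ ⟨h1, h2, h3⟩ ⟨u', v'⟩ ⟨h1', h2', h3'⟩ a b ha hb hab
  simp only [simplex, mem_ofPred_eq, Prod.smul_mk, Prod.mk_add_mk, smul_eq_mul] at *
  refine ⟨by positivity, by gcongr, ?_⟩
  nlinarith

/-- The point of the inscribed triangle with barycentric coordinates `1 - u`, `u - v` and `v`. -/
def chordPoint (u v : ℝ) : ℂ := ((1 - u : ℝ) : ℂ) * thirdTurn 2 + ((u - v : ℝ) : ℂ) * thirdTurn 1 +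
  (v : ℂ)

theorem norm_chordPoint_sq (u v : ℝ) : ‖chordPoint u v‖ ^ 2 =
    1 - 3 * ((1 - u) * (u - v) + (u - v) * v + (1 - u) * v) := by
  rw [← Complex.normSq_eq_norm_sq]
  exact normSq_combo _ _ _ (by ring)

theorem norm_chordPoint_le {u v : ℝ} (h : (u, v) ∈ simplex) : ‖chordPoint u v‖ ≤ 1 := by
  obtain ⟨h1, h2, h3⟩ := h
  simp only at h1 h2 h3
  have := norm_chordPoint_sq u v
  have a1 := mul_nonneg (sub_nonneg.2 h3) (sub_nonneg.2 h2)
  have a2 := mul_nonneg (sub_nonneg.2 h2) h1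
  have a3 := mul_nonneg (sub_nonneg.2 h3) h1
  have : ‖chordPoint u v‖ ^ 2 ≤ 1 := by linarith
  exact (sq_le_one_iff₀ (norm_nonneg _)).1 this

theorem chordPoint_vertex {u v : ℝ} (h : (u, v) ∈ simplex) (hn : ‖chordPoint u v‖ = 1) :
    (u = 0 ∧ v = 0) ∨ (u = 1 ∧ v = 0) ∨ (u = 1 ∧ v = 1) := by
  obtain ⟨h1, h2, h3⟩ := h
  simp only at h1 h2 h3
  have h4 := norm_chordPoint_sq u v
  rw [hn] at h4
  have a1 := mul_nonneg (sub_nonneg.2 h3) (sub_nonneg.2 h2)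
  have a2 := mul_nonneg (sub_nonneg.2 h2) h1
  have a3 := mul_nonneg (sub_nonneg.2 h3) h1
  have b1 : (1 - u) * (u - v) = 0 := by linarith
  have b2 : (u - v) * v = 0 := by linarith
  rcases mul_eq_zero.1 b1 with c1 | c1
  · obtain rfl : u = 1 := by linarith
    rcases mul_eq_zero.1 b2 with c2 | c2
    · exact Or.inr (Or.inr ⟨rfl, by linarith⟩)
    · exact Or.inr (Or.inl ⟨rfl, c2⟩)
  · obtain rfl : u = v := by linarith
    have b3 : (1 - u) * u = 0 := by linarith
    rcases mul_eq_zero.1 b3 with c2 | c2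
    · have : u = 1 := by linarith
      exact Or.inr (Or.inr ⟨this, this⟩)
    · exact Or.inl ⟨c2, c2⟩

theorem chordPoint_zero_zero : chordPoint 0 0 = thirdTurn 2 := by simp [chordPoint]
theorem chordPoint_one_zero : chordPoint 1 0 = thirdTurn 1 := by simp [chordPoint]
theorem chordPoint_one_one : chordPoint 1 1 = thirdTurn 0 := by simp [chordPoint]

/-- A collision with a point of the circle could only happen at the vertices of the simplex, where
the three points are distinct third roots of unity. -/
theorem chordPoint_ne {u v : ℝ} (h : (u, v) ∈ simplex) :
    chordPoint u v ≠ thirdTurn (1 + u) ∧ chordPoint u v ≠ thirdTurn v := by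
  have key : ∀ x, chordPoint u v = thirdTurn x → (u = 0 ∧ v = 0) ∨ (u = 1 ∧ v = 0) ∨
      (u = 1 ∧ v = 1) := fun x hx => chordPoint_vertex h (by rw [hx, norm_thirdTurn])
  constructor
  · intro hx
    rcases key _ hx with ⟨rfl, rfl⟩ | ⟨rfl, rfl⟩ | ⟨rfl, rfl⟩
    · rw [chordPoint_zero_zero] at hx
      exact thirdTurn_ne (by norm_num) (by norm_num) hx.symm
    · rw [chordPoint_one_zero] at hx
      exact thirdTurn_ne (by norm_num) (by norm_num) hx
    · rw [chordPoint_one_one] at hx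
      exact thirdTurn_ne (by norm_num) (by norm_num) hx
  · intro hx
    rcases key _ hx with ⟨rfl, rfl⟩ | ⟨rfl, rfl⟩ | ⟨rfl, rfl⟩
    · rw [chordPoint_zero_zero] at hx
      exact thirdTurn_ne (by norm_num) (by norm_num) hx.symm
    · rw [chordPoint_one_zero] at hx
      exact thirdTurn_ne (by norm_num) (by norm_num) hx.symm
    · rw [chordPoint_one_one] at hx
      exact thirdTurn_ne (by norm_num) (by norm_num) hx

/-- Two vertices of the triangle turn by `u` and `v` thirds while the third one moves inside. -/
def simplexConf (hP : 0 < P) (hD : Metric.closedBall 0 P ⊆ D) (x : simplex) : Conf D 3 :=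
  circleConf hP hD (chordPoint x.1.1 x.1.2) (1 + x.1.1) x.1.2 (norm_chordPoint_le x.2)
    (chordPoint_ne x.2).1 (chordPoint_ne x.2).2
    (thirdTurn_ne (by have := x.2.2.1; linarith)
      (by have := x.2.1; have := x.2.2.2; linarith)).symm

def simplexMap (hP : 0 < P) (hD : Metric.closedBall 0 P ⊆ D) : C(simplex, UConf D 3) where
  toFun x := (simplexConf hP hD x).toUConf
  continuous_toFun := by
    refine Conf.continuous_toUConf.comp (Continuous.subtype_mk (continuous_pi fun i => ?_) _)
    fin_cases i <;> simp [chordPoint] <;> fun_prop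

theorem simplexMap_coe (hP : 0 < P) (hD : Metric.closedBall 0 P ⊆ D) (x : simplex) :
    (simplexMap hP hD x).1 =
      {P * chordPoint x.1.1 x.1.2, P * thirdTurn (1 + x.1.1), P * thirdTurn x.1.2} :=
  range_vec3 _ _ _

/-- Because of this, the three edges of the simplex become loops at the triangle. -/
theorem simplexMap_vertices (hP : 0 < P) (hD : Metric.closedBall 0 P ⊆ D)
    (x : simplex) (hx : (x.1.1 = 0 ∧ x.1.2 = 0) ∨ (x.1.1 = 1 ∧ x.1.2 = 0) ∨
      (x.1.1 = 1 ∧ x.1.2 = 1)) : simplexMap hP hD x = (triangle hP hD).toUConf := by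
  refine Subtype.ext ?_
  rw [simplexMap_coe, triangle_coe]
  have e2 : (1 : ℝ) + 1 = 2 := by norm_num
  rcases hx with ⟨h1, h2⟩ | ⟨h1, h2⟩ | ⟨h1, h2⟩
  · rw [h1, h2, chordPoint_zero_zero, add_zero]
  · rw [h1, h2, chordPoint_one_zero, e2]
    exact insert_comm _ _ _
  · rw [h1, h2, chordPoint_one_one, e2]
    ext y
    simp only [mem_insert_iff, mem_singleton_iff]
    tauto

/-- The product of two half-twists along sides of the triangle is a third of a turn. -/
theorem thirdTurn_eq_mul (hDc : Convex ℝ D) (hP : 0 < P) (hD : Metric.closedBall 0 P ⊆ D) {η : ℝ}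
    (hη : 0 < η) (hD' : Metric.closedBall 0 (P + η) ⊆ D) :
    loopClass (thirdTurnPath hP hD) =
      halfTwist (triangle hP hD).toUConf ((triangle hP hD).1 1) ((triangle hP hD).1 2) *
      halfTwist (triangle hP hD).toUConf ((triangle hP hD).1 0) ((triangle hP hD).1 1) := by
  have hS : SimplyConnectedSpace simplex := by
    have : ContractibleSpace simplex := convex_simplex.contractibleSpace ⟨(0, 0), by simp [simplex]⟩
    infer_instance
  have hthin : ∀ i j : Fin 3, i ≠ j → ∃ ε₀ > 0, ∀ ε, 0 < ε → ε ≤ ε₀ →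
      IsThin (triangle hP hD).toUConf ((triangle hP hD).1 i) ((triangle hP hD).1 j) ε := by
    intro i j hij
    obtain ⟨ε₀, h0, h⟩ := exists_isThin_circle (Y := Unit)
      (ContinuousMap.const _ (triangle hP hD)) hη hD' (fun y k => norm_triangle hP hD k) hij
    exact ⟨ε₀, h0, fun ε h1 h2 => h ε h1 h2 ()⟩
  let v0 : simplex := ⟨(0, 0), by simp [simplex]⟩
  let v1 : simplex := ⟨(1, 0), by simp [simplex]⟩
  let v2 : simplex := ⟨(1, 1), by simp [simplex]⟩
  let p1 : Path v0 v1 :=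
    { toFun := fun t => ⟨((t : ℝ), 0), le_rfl, t.2.1, t.2.2⟩
      continuous_toFun := by fun_prop
      source' := by simp [v0]
      target' := by simp [v1] }
  let p2 : Path v1 v2 :=
    { toFun := fun t => ⟨(1, (t : ℝ)), t.2.1, t.2.2, le_rfl⟩
      continuous_toFun := by fun_prop
      source' := by simp [v1]
      target' := by simp [v2] }
  let d : Path v0 v2 :=
    { toFun := fun t => ⟨((t : ℝ), (t : ℝ)), t.2.1, le_rfl, t.2.2⟩
      continuous_toFun := by fun_prop
      source' := by simp [v0]
      target' := by simp [v2] }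
  have hv0 := simplexMap_vertices hP hD v0 (by simp [v0])
  have hv1 := simplexMap_vertices hP hD v1 (by simp [v1])
  have hv2 := simplexMap_vertices hP hD v2 (by simp [v2])
  let γ1 := (p1.map (simplexMap hP hD).continuous).cast hv0.symm hv1.symm
  let γ2 := (p2.map (simplexMap hP hD).continuous).cast hv1.symm hv2.symm
  let γ := (d.map (simplexMap hP hD).continuous).cast hv0.symm hv2.symm
  have t12 : ∀ x, thirdTurn 1 * thirdTurn x = thirdTurn (1 + x) := fun x => (thirdTurn_add _ _).symm
  have e2 : (1 : ℝ) + 1 = 2 := by norm_num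
  have e3 : (1 : ℝ) + 2 = 3 := by norm_num
  have h1 : halfTwist (triangle hP hD).toUConf ((triangle hP hD).1 0) ((triangle hP hD).1 1) =
      loopClass γ1 := by
    refine halfTwist_triangle hDc hP hD (norm_thirdTurn 1) (i := 0) (j := 1) (k := 2) (by decide)
      (by decide) (by decide) ?_ ?_ ?_ γ1 (fun t => ?_) (hthin 0 1 (by decide))
    · simp [triangle, circleConf, t12, e2]
    · simp [triangle, circleConf]
    · simp [triangle, circleConf, t12, e3]
    · rw [t12, t12, e3]
      refine (simplexMap_coe hP hD (p1 t)).trans ?_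
      have : chordPoint t 0 =
          thirdTurn 1 * ((1 - ((t : ℝ) : ℂ)) * thirdTurn 1 + ((t : ℝ) : ℂ)) := by
        have := t12 1
        rw [e2] at this
        simp only [chordPoint]
        push_cast
        linear_combination -(1 - ((t : ℝ) : ℂ)) * this
      rw [← this, thirdTurn_three, ← thirdTurn_zero]
      rfl
  have h2 : halfTwist (triangle hP hD).toUConf ((triangle hP hD).1 1) ((triangle hP hD).1 2) =
      loopClass γ2 := by
    refine halfTwist_triangle hDc hP hD (norm_one (α := ℂ)) (i := 1) (j := 2) (k := 0) (by decide)
      (by decide) (by decide) ?_ ?_ ?_ γ2 (fun t => ?_) (hthin 1 2 (by decide))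
    · simp [triangle, circleConf]
    · simp [triangle, circleConf]
    · simp [triangle, circleConf]
    · simp only [one_mul]
      refine (simplexMap_coe hP hD (p2 t)).trans ?_
      have : chordPoint 1 t = (1 - ((t : ℝ) : ℂ)) * thirdTurn 1 + ((t : ℝ) : ℂ) := by
        simp [chordPoint]
      rw [← this]
      change {_, (P : ℂ) * thirdTurn (1 + 1), (P : ℂ) * thirdTurn t} = _
      rw [e2]
      exact congrArg _ (pair_comm _ _)
  rw [h1, h2, loopClass_mul]
  -- The two legs of the simplex are homotopic to its diagonal, along which two vertices turn by a
  -- third while the remaining one takes the chord.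
  have hγ : (γ1.trans γ2).Homotopic γ := by
    refine homotopic_of_simplyConnected (simplexMap hP hD) (p1.trans p2) d _ _ (fun t => ?_)
      fun t => rfl
    rw [Path.trans_apply, Path.trans_apply]
    split_ifs <;> rfl
  rw [loopClass_eq hγ]
  have hchord : ∀ t : unitInterval, ((t : ℝ), (t : ℝ)) ∈ simplex := fun t => ⟨t.2.1, le_rfl, t.2.2⟩
  -- Pushing the chord out to its arc turns the diagonal into the rotation. Strictly between chord
  -- and arc the point is interior to the disc, so it misses the other two points.
  let b : unitInterval × unitInterval → ℂ := fun y =>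
    (y.1 : ℝ) • chordPoint y.2 y.2 + (1 - (y.1 : ℝ)) • thirdTurn (2 + y.2)
  have hb : ∀ y, ‖b y‖ ≤ 1 := fun y => by
    have := convex_closedBall (0 : ℂ) 1
      (mem_closedBall_zero_iff.2 (norm_chordPoint_le (hchord y.2)))
      (mem_closedBall_zero_iff.2 (norm_thirdTurn (2 + y.2)).le) y.1.2.1 (sub_nonneg.2 y.1.2.2)
      (by ring)
    exact mem_closedBall_zero_iff.1 this
  have hbne : ∀ y x, thirdTurn x ≠ chordPoint y.2 y.2 → thirdTurn x ≠ thirdTurn (2 + y.2) →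
      b y ≠ thirdTurn x := by
    intro y x hx1 hx2 he
    rcases y.1.2.1.eq_or_lt with h0 | h0
    · exact hx2 (by rw [← he]; simp [b, ← h0])
    rcases y.1.2.2.eq_or_lt with h1 | h1
    · exact hx1 (by rw [← he]; simp [b, h1])
    by_cases hcc : chordPoint y.2 y.2 = thirdTurn (2 + y.2)
    · apply hx2
      rw [← he]
      simp only [b, hcc, ← add_smul]
      simp
    · have := combo_mem_ball_of_ne (z := (0 : ℂ))
        (mem_closedBall_zero_iff.2 (norm_chordPoint_le (hchord y.2)))
        (mem_closedBall_zero_iff.2 (norm_thirdTurn (2 + y.2)).le) hcc h0 (sub_pos.2 h1) (by ring)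
      rw [mem_ball_zero_iff] at this
      exact this.ne ((congrArg norm he).trans (norm_thirdTurn x))
  let h : unitInterval × unitInterval → Conf D 3 := fun y => circleConf hP hD (b y) (1 + y.2) y.2
    (hb y) (hbne y _ (chordPoint_ne (hchord y.2)).1.symm
      (thirdTurn_ne (by linarith) (by linarith)))
    (hbne y _ (chordPoint_ne (hchord y.2)).2.symm
      (thirdTurn_ne (by linarith) (by linarith)))
    (thirdTurn_ne (by linarith) (by linarith)).symm
  have hh : Continuous h := by
    refine Continuous.subtype_mk (continuous_pi fun i => ?_) _
    fin_cases i <;> simp [b, chordPoint] <;> fun_prop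
  have hcoe : ∀ y, (h y).toUConf.1 = {P * b y, P * thirdTurn (1 + y.2), P * thirdTurn y.2} :=
    fun y => range_vec3 _ _ _
  have hend : ∀ s t, (h (s, t)).toUConf = (triangle hP hD).toUConf ↔
    ({P * b (s, t), P * thirdTurn (1 + t), P * thirdTurn t} : Set ℂ) =
      {P * thirdTurn 2, P * thirdTurn 1, P * thirdTurn 0} := by
    intro s t
    rw [← triangle_coe hP hD, ← hcoe]
    exact Subtype.ext_iff
  refine loopClass_eq (homotopic_of_rel ⟨_, Conf.continuous_toUConf.comp hh⟩ _ _ (fun t => ?_)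
    (fun t => ?_) (fun s => ?_) fun s => ?_)
  · rw [thirdTurnPath_apply]
    refine Subtype.ext ((hcoe _).trans ((turnMap_coe _ _ _).trans ?_).symm)
    simp [b]
  · refine Subtype.ext ((hcoe _).trans (Eq.trans ?_ (simplexMap_coe _ _ (d t)).symm))
    simp only [b, Icc.coe_one, one_smul, sub_self, zero_smul, add_zero]
    rfl
  · refine (hend s 0).2 ?_
    have : b (s, 0) = thirdTurn 2 := by
      simp only [b, Icc.coe_zero, chordPoint_zero_zero, add_zero, ← add_smul]
      simp
    simp [this]
  · refine (hend s 1).2 ?_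
    have : b (s, 1) = thirdTurn 0 := by
      simp only [b, Icc.coe_one, chordPoint_one_one, show (2 : ℝ) + 1 = 3 by norm_num,
        thirdTurn_three, thirdTurn_zero, ← add_smul]
      simp
    simp only [this, Icc.coe_one, e2]
    ext y
    simp only [mem_insert_iff, mem_singleton_iff]
    tauto

end Turn

/-! ### A pair of opposite points and a distant point -/

section Pair

theorem not_mem_segment_of_lt {E : Type*} [AddCommGroup E] [Module ℝ E] (l : E →ₗ[ℝ] ℝ) {x p q : E}
    (hp : l x < l p) (hq : l x < l q) : x ∉ segment ℝ p q := by
  rintro ⟨a, b, ha, hb, hab, rfl⟩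
  obtain rfl : b = 1 - a := by linarith
  simp only [map_add, map_smul, smul_eq_mul] at hp hq
  rcases ha.eq_or_lt with rfl | ha
  · simp at hq
  · nlinarith

/-- Conjugation by `b * a` takes `b` to `a`, so `b a b^(n+2) = a^(n+2) b a`; and the braid relation
gives `(b a)^3 = a^2 (b a) a b`. Both sides equal `a^(n+2) b a a b`. -/
theorem braid_pow {G : Type*} [Group G] {a b : G} (h : a * b * a = b * a * b) (n : ℕ) :
    a ^ n * (b * a) ^ 3 = b * a * b ^ (n + 2) * a * b := by
  have h1 : SemiconjBy (b * a) b a := by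
    change b * a * b = a * (b * a)
    rw [← h, mul_assoc]
  have h2 : b * a * b ^ (n + 2) = a ^ (n + 2) * (b * a) := (h1.pow_right (n + 2)).eq
  have h3 : (b * a) ^ 3 = a ^ 2 * (b * a) * a * b := by
    calc (b * a) ^ 3 = (b * a * b) * (a * b * a) := by
          simp only [pow_succ, pow_zero, one_mul, mul_assoc]
      _ = (a * b * a) * (b * a * b) := by rw [h]
      _ = a * (b * a * b) * a * b := by group
      _ = a * (a * b * a) * a * b := by rw [h]
      _ = a ^ 2 * (b * a) * a * b := by simp only [pow_two, mul_assoc]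
  rw [h2, h3, pow_add]
  group

variable {D : Set ℂ} {P : ℝ} {w : ℂ}

theorem thirdTurn_half : thirdTurn (3 / 2) = -1 := by
  apply Complex.ext
  · rw [thirdTurn_re, show 2 * Real.pi * (3 / 2) / 3 = Real.pi by ring, Real.cos_pi]; rfl
  · rw [thirdTurn_im, show 2 * Real.pi * (3 / 2) / 3 = Real.pi by ring, Real.sin_pi]; simp

/-- The points `-w` and `w` after `u` half turns, and `P` after `v` full turns. -/
def torusConf (hw : w ≠ 0) (hwP : ‖w‖ < P) (hD : Metric.closedBall 0 P ⊆ D) (x : ℝ × ℝ) :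
    Conf D 3 :=
  ⟨![-w * thirdTurn (3 / 2 * x.1), w * thirdTurn (3 / 2 * x.1), P * thirdTurn (3 * x.2)], by
    have hP : ‖(P : ℂ)‖ = P := by
      rw [Complex.norm_real, Real.norm_of_nonneg ((norm_nonneg w).trans hwP.le)]
    refine ⟨injective_vec3 ?_ ?_ ?_, fun i => hD ?_⟩
    · intro h
      have h1 : thirdTurn (3 / 2 * x.1) ≠ 0 := Complex.exp_ne_zero _
      exact hw (neg_eq_self.1 (mul_right_cancel₀ h1 h))
    · intro h
      have := congrArg norm h
      simp only [norm_mul, norm_thirdTurn, norm_neg, hP, mul_one] at this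
      exact hwP.ne this
    · intro h
      have := congrArg norm h
      simp only [norm_mul, norm_thirdTurn, hP, mul_one] at this
      exact hwP.ne this
    · rw [mem_closedBall_zero_iff]
      fin_cases i
      · simpa using hwP.le
      · simpa using hwP.le
      · simp [abs_of_pos ((norm_nonneg w).trans_lt hwP)]⟩

def torusMap (hw : w ≠ 0) (hwP : ‖w‖ < P) (hD : Metric.closedBall 0 P ⊆ D) :
    C(ℝ × ℝ, UConf D 3) where
  toFun x := (torusConf hw hwP hD x).toUConf
  continuous_toFun := by
    refine Conf.continuous_toUConf.comp (Continuous.subtype_mk (continuous_pi fun i => ?_) _)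
    fin_cases i <;> simp <;> fun_prop

theorem torusMap_coe (hw : w ≠ 0) (hwP : ‖w‖ < P) (hD : Metric.closedBall 0 P ⊆ D) (x : ℝ × ℝ) :
    (torusMap hw hwP hD x).1 = {-w * thirdTurn (3 / 2 * x.1), w * thirdTurn (3 / 2 * x.1),
      P * thirdTurn (3 * x.2)} :=
  range_vec3 _ _ _

/-- The inclusion of the integral points of the plane. -/
abbrev intPoint : ℤ × ℤ →+ ℝ × ℝ := (Int.castAddHom ℝ).prodMap (Int.castAddHom ℝ)

theorem torusMap_add_intPoint (hw : w ≠ 0) (hwP : ‖w‖ < P) (hD : Metric.closedBall 0 P ⊆ D)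
    (x : ℝ × ℝ) (n : ℤ × ℤ) : torusMap hw hwP hD (x + intPoint n) = torusMap hw hwP hD x := by
  obtain ⟨u, v⟩ := x
  obtain ⟨m, n⟩ := n
  have h1 : ∀ v, Function.Periodic (fun u => torusMap hw hwP hD (u, v)) 1 := by
    intro v u
    refine Subtype.ext ?_
    rw [torusMap_coe, torusMap_coe, show 3 / 2 * (u + 1, v).1 = 3 / 2 * u + 3 / 2 by simp; ring,
      thirdTurn_add, thirdTurn_half]
    simp only [mul_neg, mul_one, neg_mul, neg_neg]
    exact insert_comm _ _ _
  have h2 : ∀ u, Function.Periodic (fun v => torusMap hw hwP hD (u, v)) 1 := by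
    intro u v
    refine Subtype.ext ?_
    rw [torusMap_coe, torusMap_coe, show 3 * (u, v + 1).2 = 3 * v + 3 by simp; ring,
      thirdTurn_add, thirdTurn_three, mul_one]
  have e1 := (h1 (v + n)).int_mul m u
  have e2 := (h2 u).int_mul n v
  simp only [mul_one] at e1 e2
  exact e1.trans e2

/-- The configuration `-w`, `w`, `P`. -/
def pairConf (hw : w ≠ 0) (hwP : ‖w‖ < P) (hD : Metric.closedBall 0 P ⊆ D) : Conf D 3 :=
  torusConf hw hwP hD 0

theorem pairConf_apply (hw : w ≠ 0) (hwP : ‖w‖ < P) (hD : Metric.closedBall 0 P ⊆ D) :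
    (pairConf hw hwP hD).1 = ![-w, w, (P : ℂ)] := by
  simp [pairConf, torusConf]

theorem pairConf_coe (hw : w ≠ 0) (hwP : ‖w‖ < P) (hD : Metric.closedBall 0 P ⊆ D) :
    (pairConf hw hwP hD).toUConf.1 = {-w, w, (P : ℂ)} := by
  change Set.range (pairConf hw hwP hD).1 = _
  rw [pairConf_apply, range_vec3]

theorem torusMap_zero (hw : w ≠ 0) (hwP : ‖w‖ < P) (hD : Metric.closedBall 0 P ⊆ D) :
    torusMap hw hwP hD 0 = (pairConf hw hwP hD).toUConf := rfl

/-- The homomorphism taking `(m, n)` to the braid of `m` half turns of the pair and `n` full turns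
of the third point. -/
def torusHom (hw : w ≠ 0) (hwP : ‖w‖ < P) (hD : Metric.closedBall 0 P ⊆ D) :
    Multiplicative (ℤ × ℤ) →* FundamentalGroup (UConf D 3) (pairConf hw hwP hD).toUConf :=
  periodHom (torusMap hw hwP hD) intPoint (torusMap_add_intPoint hw hwP hD)
    (torusMap_zero hw hwP hD)

/-- With `ε = 1` the ellipse on the segment from `-w` to `w` is the round disc of radius `‖w‖`,
which omits `P`. The twist motion is then literally the rotation of the pair. -/
theorem torusHom_one_zero (hw : w ≠ 0) (hwP : ‖w‖ < P) (hD : Metric.closedBall 0 P ⊆ D) :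
    torusHom hw hwP hD (Multiplicative.ofAdd (1, 0)) =
      halfTwist (pairConf hw hwP hD).toUConf (-w) w := by
  have hell : ∀ u, ellipseMap (-w) w 1 u = w * u := by
    intro u
    simp only [ellipseMap, one_mul, Complex.re_add_im]
    ring
  have hne : -w ≠ w := fun h => hw (neg_eq_self.1 h)
  have hsub : ∀ y ∈ ellipse (-w) w 1, ‖y‖ ≤ ‖w‖ := by
    rintro _ ⟨u, hu, rfl⟩
    rw [hell, norm_mul]
    exact mul_le_of_le_one_right (norm_nonneg _) (mem_closedBall_zero_iff.1 hu)
  have hP : ‖(P : ℂ)‖ = P := by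
    rw [Complex.norm_real, Real.norm_of_nonneg ((norm_nonneg w).trans hwP.le)]
  have hthin : IsThin (pairConf hw hwP hD).toUConf (-w) w 1 := by
    refine ⟨hne, one_pos, fun y hy => hD (mem_closedBall_zero_iff.2 ((hsub y hy).trans hwP.le)), ?_⟩
    rw [pairConf_coe]
    apply Set.Subset.antisymm
    · rintro y ⟨rfl | rfl | rfl, hy⟩
      · simp
      · simp
      · have := hsub _ hy
        rw [hP] at this
        exact absurd hwP this.not_gt
    · rintro y (rfl | rfl)
      · exact ⟨by simp, -1, by simp, by rw [hell]; simp⟩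
      · exact ⟨by simp, 1, by simp, by rw [hell]; simp⟩
  rw [halfTwist_eq hthin]
  refine (loopClass_eq_periodHom (torusMap hw hwP hD) intPoint (torusMap_add_intPoint hw hwP hD)
    (torusMap_zero hw hwP hD) (1, 0) _ fun t => Subtype.ext ?_).symm
  rw [twistPath_apply, torusMap_coe, pairConf_coe, image_insert_eq, image_pair]
  have h1 : twistMotion (-w) w 1 t (-w) = -w * thirdTurn (3 / 2 * t) := by
    rw [twistMotion, if_pos rfl, hell, thirdTurn, neg_mul, mul_neg]
    congr 4
    push_cast
    ring
  have h2 : twistMotion (-w) w 1 t w = w * thirdTurn (3 / 2 * t) := by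
    rw [twistMotion, if_neg hne.symm, if_pos rfl, hell, thirdTurn]
    congr 3
    push_cast
    ring
  have h3 : twistMotion (-w) w 1 t P = P := by
    rw [twistMotion, if_neg, if_neg]
    · intro h
      have := congrArg norm h
      rw [hP] at this
      exact hwP.ne' this
    · intro h
      have := congrArg norm h
      rw [hP, norm_neg] at this
      exact hwP.ne' this
  rw [h1, h2, h3]
  simp

/-- The linear motion from the configuration `-w`, `w`, `P` to an equilateral triangle. -/
def mixTuple (w : ℂ) (P s : ℝ) : Fin 3 → ℂ :=
  ![-((1 - s) • w) + s • (P * thirdTurn 2), (1 - s) • w + s • (P * thirdTurn 1), P]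

theorem mixTuple_zero : mixTuple w P 0 = ![-w, w, (P : ℂ)] := by simp [mixTuple]

theorem norm_mixTuple (hwP : ‖w‖ < P) (s : unitInterval) (i : Fin 3) : ‖mixTuple w P s i‖ ≤ P := by
  have hP0 : 0 < P := (norm_nonneg w).trans_lt hwP
  have key : ∀ b c : ℂ, ‖b‖ ≤ P → ‖c‖ ≤ P → ‖(1 - (s : ℝ)) • b + (s : ℝ) • c‖ ≤ P := by
    intro b c hb hc
    exact mem_closedBall_zero_iff.1 (convex_closedBall (0 : ℂ) P (mem_closedBall_zero_iff.2 hb)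
      (mem_closedBall_zero_iff.2 hc) (sub_nonneg.2 s.2.2) s.2.1 (by ring))
  have hP : ‖(P : ℂ)‖ = P := by rw [Complex.norm_real, Real.norm_of_nonneg hP0.le]
  fin_cases i
  · have := key (-w) (P * thirdTurn 2) (by rw [norm_neg]; exact hwP.le) (by simp [abs_of_pos hP0])
    rwa [smul_neg] at this
  · exact key w (P * thirdTurn 1) hwP.le (by simp [abs_of_pos hP0])
  · exact hP.le

/-- The sum of real and imaginary part. -/
def reAddIm : ℂ →ₗ[ℝ] ℝ := Complex.reLm + Complex.imLm

theorem reAddIm_apply (x : ℂ) : reAddIm x = x.re + x.im := rfl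

/-- The sum of real and imaginary part separates `-w` from `w` both for positive `w` and for `w` on
the positive imaginary axis, and it orders the target triangle in the same way. The order thus
persists along the linear motion; this rules out collisions and keeps point 0 off the segment from 1
to 2. -/
theorem reAddIm_mixTuple (hP : 0 < P) (hw0 : 0 < w.re + w.im) (hw1 : w.re + w.im < P)
    (s : unitInterval) : reAddIm (mixTuple w P s 0) < reAddIm (mixTuple w P s 1) ∧
      reAddIm (mixTuple w P s 1) < reAddIm (mixTuple w P s 2) := by
  have e0 : reAddIm (mixTuple w P s 0) =
      -((1 - s) * (w.re + w.im)) + s * (P * (-1 / 2 - √3 / 2)) := by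
    simp [reAddIm_apply, mixTuple, thirdTurn_two]; ring
  have e1 : reAddIm (mixTuple w P s 1) =
      (1 - s) * (w.re + w.im) + s * (P * (-1 / 2 + √3 / 2)) := by
    simp [reAddIm_apply, mixTuple, thirdTurn_one]; ring
  have e2 : reAddIm (mixTuple w P s 2) = P := by
    simp [reAddIm_apply, mixTuple]
  rw [e0, e1, e2]
  have h3 : 0 < √3 := by positivity
  have h4 : √3 < 2 := by
    rw [Real.sqrt_lt' two_pos]; norm_num
  have hs0 := s.2.1
  have hs1 := s.2.2
  have a1 : 0 < P * √3 := by positivity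
  have a2 : P * (-1 / 2 + √3 / 2) < P := by nlinarith
  rcases hs0.eq_or_lt with h | h
  · rw [← h]
    constructor <;> linarith
  · have b1 := mul_pos h a1
    have b2 := mul_nonneg (sub_nonneg.2 hs1) hw0.le
    have b3 := mul_lt_mul_of_pos_left a2 h
    have b4 := mul_le_mul_of_nonneg_left hw1.le (sub_nonneg.2 hs1)
    constructor <;> linarith

theorem injective_mixTuple (hP : 0 < P) (hw0 : 0 < w.re + w.im) (hw1 : w.re + w.im < P)
    (s : unitInterval) : Function.Injective (mixTuple w P s) := by
  obtain ⟨h1, h2⟩ := reAddIm_mixTuple hP hw0 hw1 s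
  have : mixTuple w P s = ![mixTuple w P s 0, mixTuple w P s 1, mixTuple w P s 2] := by
    ext i; fin_cases i <;> rfl
  rw [this]
  exact injective_vec3 (fun h => h1.ne (congrArg _ h)) (fun h => (h1.trans h2).ne (congrArg _ h))
    fun h => h2.ne (congrArg _ h)

theorem re_mixTuple (hwP : ‖w‖ < P) (s : unitInterval) :
    (mixTuple w P s 0).re < P ∧ (mixTuple w P s 1).re < P := by
  have hP : 0 < P := (norm_nonneg w).trans_lt hwP
  have hre := abs_lt.1 ((Complex.abs_re_le_norm w).trans_lt hwP)
  have e0 : (mixTuple w P s 0).re = (1 - s) * (-w.re) + s * (P * (-1 / 2)) := by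
    simp [mixTuple, thirdTurn_two]
  have e1 : (mixTuple w P s 1).re = (1 - s) * w.re + s * (P * (-1 / 2)) := by
    simp [mixTuple, thirdTurn_one]
  rw [e0, e1]
  have hs0 := s.2.1
  have hs1 := s.2.2
  rcases hs0.eq_or_lt with h | h
  · rw [← h]
    constructor <;> linarith
  · have b1 := mul_pos h hP
    have b2 := mul_le_mul_of_nonneg_left hre.1.le (sub_nonneg.2 hs1)
    have b3 := mul_le_mul_of_nonneg_left hre.2.le (sub_nonneg.2 hs1)
    constructor <;> linarith

/-- Both identities are pulled back from the triangle along the isomorphism `e` given by the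
deformation `mixTuple`, which sends `σ₁` and `σ₂` to half-twists along sides. -/
theorem pair_relations (hDc : Convex ℝ D) (hD : Metric.closedBall 0 P ⊆ D) {η : ℝ} (hη : 0 < η)
    (hD' : Metric.closedBall 0 (P + η) ⊆ D) (hw : w ≠ 0) (hwP : ‖w‖ < P) (hw0 : 0 < w.re + w.im)
    (hw1 : w.re + w.im < P) {σ₁ σ₂ : BraidGroup (pairConf hw hwP hD).toUConf}
    (hσ₁ : σ₁ = halfTwist _ (-w) w) (hσ₂ : σ₂ = halfTwist _ w P) :
    σ₁ * σ₂ * σ₁ = σ₂ * σ₁ * σ₂ ∧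
      torusHom hw hwP hD (Multiplicative.ofAdd (2, 1)) = (σ₂ * σ₁) ^ 3 := by
  have hP : 0 < P := (norm_nonneg w).trans_lt hwP
  let z : C(unitInterval, Conf D 3) := ⟨fun s => ⟨mixTuple w P s, injective_mixTuple hP hw0 hw1 s,
    fun i => hD (mem_closedBall_zero_iff.2 (norm_mixTuple hwP s i))⟩, by
      refine Continuous.subtype_mk (continuous_pi fun i => ?_) _
      fin_cases i <;> simp [mixTuple] <;> fun_prop⟩
  have hz0 : z 0 = pairConf hw hwP hD := Subtype.ext (by
    rw [pairConf_apply]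
    exact mixTuple_zero)
  have hz1 : z 1 = triangle hP hD := Subtype.ext (by
    simp [z, mixTuple, triangle, circleConf])
  let g : Path (pairConf hw hwP hD).toUConf (triangle hP hD).toUConf :=
    { toFun := fun s => (z s).toUConf
      continuous_toFun := Conf.continuous_toUConf.comp z.continuous
      source' := congrArg _ hz0
      target' := congrArg _ hz1 }
  obtain ⟨ε₁, hε₁, ht₁⟩ := exists_isThin_uniform z hη hD' (fun s i => norm_mixTuple hwP s i)
    (show (0 : Fin 3) ≠ 1 by decide) (fun s k h1 h2 => by
      obtain rfl : k = 2 := by omega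
      obtain ⟨a, b⟩ := re_mixTuple hwP s
      exact not_mem_segment_of_lt (-Complex.reLm) (neg_lt_neg a) (neg_lt_neg b))
  obtain ⟨ε₂, hε₂, ht₂⟩ := exists_isThin_uniform z hη hD' (fun s i => norm_mixTuple hwP s i)
    (show (1 : Fin 3) ≠ 2 by decide) (fun s k h1 h2 => by
      obtain rfl : k = 0 := by omega
      obtain ⟨a, b⟩ := reAddIm_mixTuple hP hw0 hw1 s
      exact not_mem_segment_of_lt reAddIm a (a.trans b))
  set e := FundamentalGroup.fundamentalGroupMulEquivOfPath g with he
  have hz0' : (z 0).1 = ![-w, w, (P : ℂ)] := mixTuple_zero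
  have e1 : e σ₁ = halfTwist (triangle hP hD).toUConf ((triangle hP hD).1 0)
      ((triangle hP hD).1 1) := by
    rw [hσ₁]
    exact halfTwist_transport g z (fun s => rfl) 0 1 (ht₁ _ hε₁ le_rfl) (by rw [hz0']; rfl)
      (by rw [hz0']; rfl) (by rw [hz1]) (by rw [hz1])
  have e2 : e σ₂ = halfTwist (triangle hP hD).toUConf ((triangle hP hD).1 1)
      ((triangle hP hD).1 2) := by
    rw [hσ₂]
    exact halfTwist_transport g z (fun s => rfl) 1 2 (ht₂ _ hε₂ le_rfl) (by rw [hz0']; rfl)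
      (by rw [hz0']; rfl) (by rw [hz1]) (by rw [hz1])
  have hδ := thirdTurn_eq_mul hDc hP hD hη hD'
  have hconj := thirdTurn_conj hP hD hη hD'
  rw [← e1, ← e2] at hδ hconj
  constructor
  · apply e.injective
    rw [hδ] at hconj
    simp only [map_mul]
    rw [hconj, mul_assoc]
  · apply e.injective
    rw [map_pow, map_mul, ← hδ, ← turnHom_eq_pow]
    -- Each stage of the deformation is rotated rigidly through a full turn. This is a free homotopy
    -- from the turn of `-w, w, P` to the turn of the triangle, and its base point traces `g`.
    let h : unitInterval × unitInterval → Fin 3 → ℂ := fun y i =>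
      mixTuple w P y.1 i * thirdTurn (3 * y.2)
    have hh : ∀ y, Function.Injective (h y) ∧ ∀ i, h y i ∈ D := by
      intro y
      refine ⟨fun i j hij => injective_mixTuple hP hw0 hw1 y.1
        (mul_right_cancel₀ (Complex.exp_ne_zero _ : thirdTurn _ ≠ 0) hij), fun i => hD ?_⟩
      rw [mem_closedBall_zero_iff, norm_mul, norm_thirdTurn, mul_one]
      exact norm_mixTuple hwP _ _
    have hcont : ∀ i, Continuous fun y => h y i := by
      intro i
      have : Continuous fun s : unitInterval => mixTuple w P s i :=
        (continuous_apply i).comp (continuous_subtype_val.comp z.continuous)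
      exact (this.comp continuous_fst).mul (continuous_thirdTurn.comp
        (continuous_const.mul (continuous_subtype_val.comp continuous_snd)))
    refine conj_loopClass g _ _ (homotopic_of_square ⟨_, continuous_toUConf_mk hcont hh⟩ _ _ _ _
      (fun t => ?_) (fun t => ?_) (fun s => ?_) fun s => ?_)
    · refine Subtype.ext (Eq.trans ?_ (torusMap_coe _ _ _ _).symm)
      have e3 : h (0, t) = ![-w * thirdTurn (3 * t), w * thirdTurn (3 * t),
          P * thirdTurn (3 * t)] := by
        ext i
        simp only [h, Icc.coe_zero, mixTuple_zero]
        fin_cases i <;> rfl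
      change Set.range (h (0, t)) = _
      rw [e3, range_vec3]
      have e4 : 3 / 2 * ((t : ℝ) * 2) = 3 * t := by ring
      simp [e4]
    · refine Subtype.ext (Eq.trans ?_ (turnMap_coe _ _ _).symm)
      have e3 : h (1, t) = ![P * thirdTurn (2 + 3 * t), P * thirdTurn (1 + 3 * t),
          P * thirdTurn (3 * t)] := by
        ext i
        simp only [h, thirdTurn_add]
        fin_cases i <;> simp [mixTuple, mul_assoc]
      change Set.range (h (1, t)) = _
      rw [e3, range_vec3]
      have e4 : (t : ℝ) * 3 = 3 * t := by ring
      simp [e4]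
    · refine Subtype.ext (congrArg Set.range ?_)
      ext i
      simp [h, z]
    · refine Subtype.ext (congrArg Set.range ?_)
      ext i
      simp [h, z]

/-- The braid of `n` half turns of the pair while the third point makes one turn. -/
theorem torusHom_eq (hDc : Convex ℝ D) (hD : Metric.closedBall 0 P ⊆ D) {η : ℝ} (hη : 0 < η)
    (hD' : Metric.closedBall 0 (P + η) ⊆ D) (hw : w ≠ 0) (hwP : ‖w‖ < P) (hw0 : 0 < w.re + w.im)
    (hw1 : w.re + w.im < P) (hlex : lexKey (-w) < lexKey w) {n : ℕ} (hn : 2 ≤ n)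
    {σ₁ σ₂ : BraidGroup (pairConf hw hwP hD).toUConf}
    (hσ₁ : σ₁ = artinGen _ 1) (hσ₂ : σ₂ = artinGen _ 2) :
    torusHom hw hwP hD (Multiplicative.ofAdd ((n : ℤ), 1)) = σ₂ * σ₁ * σ₂ ^ n * σ₁ * σ₂ := by
  have hmono : StrictMono fun i => lexKey ((pairConf hw hwP hD).1 i) := by
    rw [pairConf_apply, Fin.strictMono_iff_lt_succ]
    intro i
    fin_cases i
    · exact hlex
    · refine Prod.Lex.toLex_lt_toLex.2 (Or.inl ?_)
      simpa using (le_abs_self _).trans_lt ((Complex.abs_re_le_norm w).trans_lt hwP)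
  have hpt := fun i => ((pairConf hw hwP hD).pt_toUConf hmono i).trans
    (congrFun (pairConf_apply hw hwP hD) i)
  have h1 : σ₁ = halfTwist _ (-w) w := by
    rw [hσ₁, artinGen, dif_pos (by decide)]
    simp [hpt]
  have h2 : σ₂ = halfTwist _ w P := by
    rw [hσ₂, artinGen, dif_pos (by decide)]
    simp [hpt]
  obtain ⟨hb, hr⟩ := pair_relations hDc hD hη hD' hw hwP hw0 hw1 h1 h2
  -- Write `n = m + 2`, so that `(n, 1) = m (1, 0) + (2, 1)`: two of the half turns join the third
  -- point in a rigid full turn.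
  obtain ⟨m, rfl⟩ := Nat.exists_eq_add_of_le' hn
  rw [← braid_pow hb, ← hr, h1, ← torusHom_one_zero, ← map_pow, ← map_mul, ← ofAdd_nsmul,
    ← ofAdd_add]
  congr 2
  simp

end Pair

/-! ### The curves -/

section Curve

open Metric Polynomial

/-- A curve of the form `(y² - ζ² x^ν)(y - a x) = 0`. -/
structure IsTangentCurve (F : Polynomial (Polynomial ℂ)) (ν : ℕ) (a : ℝ) (ζ : ℂ) : Prop where
  evalEval_eq : ∀ x y, F.evalEval x y = (y ^ 2 - ζ ^ 2 * x ^ ν) * (y - a * x)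
  norm_eq : ‖ζ‖ = 1
  re_add_im : ζ.re + ζ.im = 1
  lex_lt : ∀ ρ : ℝ, 0 < ρ → lexKey (-(ζ * ρ)) < lexKey (ζ * ρ)

theorem isTangentCurve_curveG1 (ν : ℕ) (a : ℝ) : IsTangentCurve (curveG1 ν a) ν a 1 where
  evalEval_eq x y := by simp [curveG1, evalEval]
  norm_eq := norm_one
  re_add_im := by simp
  lex_lt ρ hρ := Prod.Lex.toLex_lt_toLex.2 (Or.inl (by simp; linarith))

theorem isTangentCurve_curveG2 (ν : ℕ) (a : ℝ) : IsTangentCurve (curveG2 ν a) ν a Complex.I where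
  evalEval_eq x y := by simp [curveG2, evalEval]
  norm_eq := Complex.norm_I
  re_add_im := by simp
  lex_lt ρ hρ := Prod.Lex.toLex_lt_toLex.2 (Or.inr (by simp; linarith))

theorem natDegree_curveG1 (ν : ℕ) (a : ℝ) : (curveG1 ν a).natDegree = 3 := by
  rw [curveG1, ((monic_X_pow_sub_C _ two_ne_zero).natDegree_mul (monic_X_sub_C _)),
    natDegree_X_pow_sub_C, natDegree_X_sub_C]

theorem natDegree_curveG2 (ν : ℕ) (a : ℝ) : (curveG2 ν a).natDegree = 3 := by
  rw [curveG2, ((monic_X_pow_add_C _ two_ne_zero).natDegree_mul (monic_X_sub_C _)),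
    natDegree_X_pow_add_C, natDegree_X_sub_C]

variable {F : Polynomial (Polynomial ℂ)} {ν : ℕ} {a : ℝ} {ζ : ℂ}

/-- The points of the curve above `e^u`. -/
def sheets (ν : ℕ) (a : ℝ) (ζ u : ℂ) : Fin 3 → ℂ :=
  ![-(ζ * Complex.exp (ν * u / 2)), ζ * Complex.exp (ν * u / 2), a * Complex.exp u]

theorem continuous_sheets (i : Fin 3) : Continuous fun u => sheets ν a ζ u i := by
  fin_cases i <;> simp [sheets] <;> fun_prop

namespace IsTangentCurve

theorem mem_fiber (hF : IsTangentCurve F ν a ζ) (x y : ℂ) :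
    y ∈ fiber F x ↔ y ^ 2 = ζ ^ 2 * x ^ ν ∨ y = a * x := by
  rw [fiber, mem_ofPred_eq, hF.evalEval_eq, mul_eq_zero, sub_eq_zero, sub_eq_zero]

theorem fiber_exp (hF : IsTangentCurve F ν a ζ) (u : ℂ) :
    fiber F (Complex.exp u) = Set.range (sheets ν a ζ u) := by
  rw [sheets, range_vec3]
  have e : ζ ^ 2 * Complex.exp u ^ ν = (ζ * Complex.exp (ν * u / 2)) ^ 2 := by
    rw [mul_pow, ← Complex.exp_nat_mul, ← Complex.exp_nat_mul]
    congr 2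
    push_cast
    ring
  ext y
  rw [hF.mem_fiber, e, sq_eq_sq_iff_eq_or_eq_neg]
  simp only [mem_insert_iff, mem_singleton_iff]
  tauto

theorem ne_zero (hF : IsTangentCurve F ν a ζ) : ζ ≠ 0 := by
  rintro rfl
  simpa using hF.norm_eq

/-- After squaring, the claim is $|x|^{\nu-2}|x|^2<a^2|x|^2$ for $x=e^u$. -/
theorem norm_lt (hF : IsTangentCurve F ν a ζ) (hν : 2 ≤ ν) (ha : 0 < a) {u : ℂ}
    (hu : ‖Complex.exp u‖ ^ (ν - 2) < a ^ 2) :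
    ‖ζ * Complex.exp (ν * u / 2)‖ < ‖a * Complex.exp u‖ := by
  have h0 : 0 < ‖Complex.exp u‖ := norm_pos_iff.2 (Complex.exp_ne_zero _)
  have e : ‖Complex.exp (ν * u / 2)‖ ^ 2 = ‖Complex.exp u‖ ^ (ν - 2) * ‖Complex.exp u‖ ^ 2 := by
    rw [← pow_add, Nat.sub_add_cancel hν, ← norm_pow, ← norm_pow, ← Complex.exp_nat_mul,
      ← Complex.exp_nat_mul]
    congr 2
    push_cast
    ring
  rw [norm_mul, norm_mul, hF.norm_eq, one_mul, Complex.norm_real, Real.norm_of_nonneg ha.le]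
  refine lt_of_pow_lt_pow_left₀ 2 (by positivity) ?_
  rw [e, mul_pow]
  gcongr

theorem injective_sheets (hF : IsTangentCurve F ν a ζ) (hν : 2 ≤ ν) (ha : 0 < a) {u : ℂ}
    (hu : ‖Complex.exp u‖ ^ (ν - 2) < a ^ 2) : Function.Injective (sheets ν a ζ u) := by
  have h := hF.norm_lt hν ha hu
  refine injective_vec3 ?_ ?_ ?_
  · intro he
    exact mul_ne_zero hF.ne_zero (Complex.exp_ne_zero _) (neg_eq_self.1 he)
  · intro he
    rw [← he, norm_neg] at h
    exact h.false
  · intro he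
    rw [← he] at h
    exact h.false

theorem not_mem_branchSet (hF : IsTangentCurve F ν a ζ) (hν : 2 ≤ ν) (ha : 0 < a) {x : ℂ}
    (hx : x ≠ 0) (h : ‖x‖ ^ (ν - 2) < a ^ 2) : x ∉ branchSet F 3 := by
  rw [← Complex.exp_log hx] at h ⊢
  rw [branchSet, mem_ofPred_eq, not_not, hF.fiber_exp, ← image_univ,
    (hF.injective_sheets hν ha h).encard_image]
  simp

theorem zero_mem_branchSet (hF : IsTangentCurve F ν a ζ) (hν : 1 ≤ ν) : 0 ∈ branchSet F 3 := by
  have : fiber F 0 = {0} := by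
    ext y
    rw [hF.mem_fiber, zero_pow (by omega)]
    simp
  rw [branchSet, mem_ofPred_eq, this, encard_singleton]
  decide

/-- If the bound failed, a root of $x^{\nu-2}=a^2/\zeta^2$ would lie in the disc. There
$\zeta^2x^\nu=(ax)^2$, so the fibre is contained in $\{ax,-ax\}$, and $x$ is a nonzero point of $N$.
-/
theorem pow_lt (hF : IsTangentCurve F ν a ζ) (hν : 3 ≤ ν) (ha : 0 < a) {r : ℝ} (hr : 0 < r)
    (hN : closedBall 0 r ∩ branchSet F 3 = {0}) : r ^ (ν - 2) < a ^ 2 := by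
  by_contra! hcon
  have hk : ν - 2 ≠ 0 := by omega
  obtain ⟨x, hx⟩ := IsAlgClosed.exists_pow_nat_eq ((a : ℂ) ^ 2 / ζ ^ 2) (Nat.pos_of_ne_zero hk)
  have hζ := hF.ne_zero
  have ha' : (a : ℂ) ≠ 0 := Complex.ofReal_ne_zero.2 ha.ne'
  have hx0 : x ≠ 0 := by
    rintro rfl
    rw [zero_pow hk] at hx
    exact div_ne_zero (pow_ne_zero 2 ha') (pow_ne_zero 2 hζ) hx.symm
  have hn : ‖x‖ ^ (ν - 2) = a ^ 2 := by
    rw [← norm_pow, hx, norm_div, norm_pow, norm_pow, hF.norm_eq, Complex.norm_real,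
      Real.norm_of_nonneg ha.le]
    simp
  have hxr : ‖x‖ ≤ r := le_of_pow_le_pow_left₀ hk hr.le (hn.trans_le hcon)
  have hxN : x ∈ branchSet F 3 := by
    have e : ζ ^ 2 * x ^ ν = (a * x) ^ 2 := by
      have : x ^ ν = x ^ (ν - 2) * x ^ 2 := by rw [← pow_add, Nat.sub_add_cancel (by omega)]
      rw [this, hx]
      field_simp
    have hsub : fiber F x ⊆ {a * x, -(a * x)} := by
      intro y hy
      rw [hF.mem_fiber, e, sq_eq_sq_iff_eq_or_eq_neg] at hy
      simp only [mem_insert_iff, mem_singleton_iff]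
      tauto
    intro h3
    have := (encard_le_encard hsub).trans (encard_insert_le _ _)
    rw [h3, encard_singleton] at this
    exact absurd this (by decide)
  have : x ∈ closedBall 0 r ∩ branchSet F 3 := ⟨mem_closedBall_zero_iff.2 hxr, hxN⟩
  rw [hN] at this
  exact hx0 this

theorem exists_radius (hF : IsTangentCurve F ν a ζ) (hν : 3 ≤ ν) (ha : 0 < a) :
    ∃ r₀ : ℝ, 0 < r₀ ∧ ∀ r : ℝ, 0 < r → r < r₀ → closedBall 0 r ∩ branchSet F 3 = {0} := by
  -- The bound 1 gives $|x|^{\nu-2}\le|x|$, since $\nu-2\ge1$; the bound $a^2$ then suffices.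
  refine ⟨min 1 (a ^ 2), by positivity, fun r hr hr₀ => ?_⟩
  rw [lt_min_iff] at hr₀
  apply Set.Subset.antisymm
  · rintro x ⟨hx, hxN⟩
    rw [mem_closedBall_zero_iff] at hx
    by_contra hx0
    refine hF.not_mem_branchSet (by omega) ha hx0 ?_ hxN
    calc ‖x‖ ^ (ν - 2) ≤ ‖x‖ := pow_le_of_le_one (norm_nonneg _) (hx.trans hr₀.1.le) (by omega)
      _ < a ^ 2 := hx.trans_lt hr₀.2
  · rintro _ rfl
    exact ⟨by simpa using hr.le, hF.zero_mem_branchSet (by omega)⟩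

end IsTangentCurve

/-! ### The fundamental group of the punctured disc -/

theorem exists_log_path (γ : C(unitInterval, ℂ)) (hγ : ∀ t, γ t ≠ 0) (u₀ : ℂ)
    (h0 : γ 0 = Complex.exp u₀) :
    ∃ u : C(unitInterval, ℂ), (∀ t, Complex.exp (u t) = γ t) ∧ u 0 = u₀ := by
  obtain ⟨u, hu, hu0⟩ := Complex.isCoveringMap_exp.exists_path_lifts
    (⟨fun t => ⟨γ t, hγ t⟩, by fun_prop⟩ : C(unitInterval, {z : ℂ // z ≠ 0})) u₀
    (Subtype.ext h0)
  exact ⟨u, fun t => congrArg Subtype.val (congrFun hu t), hu0⟩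

section PuncturedDisc

variable {N : Set ℂ} {r : ℝ} (hr : 0 < r) (hN : closedBall 0 r ∩ N = {0})

theorem coe_ne_zero (hN : closedBall 0 r ∩ N = {0}) (x : ↥(closedBall (0 : ℂ) r \ N)) :
    (x : ℂ) ≠ 0 := by
  intro h
  have : (0 : ℂ) ∈ closedBall 0 r ∩ N := hN.ge rfl
  exact x.2.2 (by rw [h]; exact this.2)

/-- Polar coordinates on the punctured disc. -/
def polarMap : C(ℂ, ↥(closedBall (0 : ℂ) r \ N)) where
  -- Folding the plane by `-|Re u|` keeps the image in the disc while the domain is all of `ℂ`, as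
  -- the period construction needs a vector space.
  toFun u := ⟨r * Complex.exp ((-|u.re| : ℝ) + u.im * Complex.I), by
    have hle : ‖(r : ℂ) * Complex.exp ((-|u.re| : ℝ) + u.im * Complex.I)‖ ≤ r := by
      rw [norm_mul, Complex.norm_real, Real.norm_of_nonneg hr.le, Complex.norm_exp]
      refine mul_le_of_le_one_right hr.le (Real.exp_le_one_iff.2 ?_)
      simp
    refine ⟨mem_closedBall_zero_iff.2 hle, fun h => ?_⟩
    have := hN.le ⟨mem_closedBall_zero_iff.2 hle, h⟩
    exact mul_ne_zero (Complex.ofReal_ne_zero.2 hr.ne') (Complex.exp_ne_zero _) this⟩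
  continuous_toFun := by
    apply Continuous.subtype_mk
    fun_prop

theorem polarMap_add (u : ℂ) (n : ℤ) :
    polarMap hr hN (u + zmultiplesHom ℂ (2 * Real.pi * Complex.I) n) = polarMap hr hN u := by
  refine Subtype.ext ?_
  simp only [polarMap, ContinuousMap.coe_mk, zmultiplesHom_apply]
  have h1 : (u + n • (2 * Real.pi * Complex.I)).re = u.re := by simp
  have h2 : (u + n • (2 * Real.pi * Complex.I)).im = u.im + n * (2 * Real.pi) := by simp
  rw [h1, h2]
  congr 1
  rw [Complex.exp_eq_exp_iff_exists_int]
  refine ⟨n, ?_⟩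
  push_cast
  ring

theorem polarMap_zero : polarMap hr hN 0 = basePoint hr hN := by
  refine Subtype.ext ?_
  simp [polarMap, basePoint]

theorem polarMap_coe_of_nonpos {u : ℂ} (hu : u.re ≤ 0) :
    (polarMap hr hN u : ℂ) = r * Complex.exp u := by
  simp only [polarMap, ContinuousMap.coe_mk]
  rw [abs_of_nonpos hu, neg_neg, Complex.re_add_im]

/-- The circle generates the fundamental group of the punctured disc. -/
theorem zpowers_circleLoop : Subgroup.zpowers (loopClass (circleLoop hr hN)) = ⊤ := by
  rw [eq_top_iff]
  rintro x -
  obtain ⟨γ, rfl⟩ := Path.Homotopic.Quotient.mk_surjective x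
  set f := zmultiplesHom ℂ (2 * Real.pi * Complex.I) with hf
  have hcirc : loopClass (circleLoop hr hN) = periodHom (polarMap hr hN) f (polarMap_add hr hN)
      (polarMap_zero hr hN) (Multiplicative.ofAdd 1) := by
    refine loopClass_eq_periodHom _ _ _ _ _ _ fun t => Subtype.ext ?_
    rw [polarMap_coe_of_nonpos]
    · simp only [circleLoop, Path.coe_mk_mk, hf, zmultiplesHom_apply, one_smul, Complex.real_smul]
      congr 2
      ring
    · simp [hf]
  have hr0 : (r : ℂ) ≠ 0 := Complex.ofReal_ne_zero.2 hr.ne'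
  obtain ⟨u, hu, hu0⟩ := exists_log_path
    ⟨fun t => (γ t : ℂ) / r, (continuous_subtype_val.comp γ.continuous).div_const _⟩
    (fun t => div_ne_zero (coe_ne_zero hN _) hr0) 0
    ((congrArg (fun x : ↥(closedBall (0 : ℂ) r \ N) => (x : ℂ) / r) γ.source).trans
      (by simp [basePoint, hr0]))
  simp only [ContinuousMap.coe_mk] at hu
  -- The logarithm of a path in the disc stays in the left half-plane, where `polarMap` is `r exp
  -- u`.
  have hre : ∀ t, (u t).re ≤ 0 := by
    intro t
    have h1 : ‖Complex.exp (u t)‖ ≤ 1 := by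
      rw [hu, norm_div, Complex.norm_real, Real.norm_of_nonneg hr.le]
      exact (div_le_one hr).2 (mem_closedBall_zero_iff.1 (γ t).2.1)
    rwa [Complex.norm_exp, Real.exp_le_one_iff] at h1
  obtain ⟨n, hn⟩ : ∃ n : ℤ, u 1 = f n := by
    have h1 := hu 1
    rw [Path.target] at h1
    simp only [basePoint, div_self hr0] at h1
    obtain ⟨n, hn⟩ := Complex.exp_eq_one_iff.1 h1
    exact ⟨n, by rw [hn, hf, zmultiplesHom_apply, zsmul_eq_mul]⟩
  refine ⟨n, ?_⟩
  change loopClass (circleLoop hr hN) ^ n = loopClass γ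
  rw [hcirc, ← map_zpow, ← ofAdd_zsmul, smul_eq_mul, mul_one]
  refine (loopClass_eq_periodLoop _ f (polarMap_add hr hN) (polarMap_zero hr hN) n
    ⟨u, hu0, hn⟩ γ fun t => Subtype.ext ?_).symm
  refine Eq.trans ?_ (polarMap_coe_of_nonpos hr hN (hre t)).symm
  rw [hu]
  field_simp

end PuncturedDisc

/-! ### The braid monodromy -/

/-- A curve whose fibres form a continuous family of configurations along which loops lift has a
braid monodromy, the map on fundamental groups. -/
theorem isBraidMonodromy_map {n : ℕ} {E D : Set ℂ} (hD : ∀ x ∈ E, fiber F x ⊆ D)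
    (M : ↥(E \ branchSet F n)) (hc : Continuous (fiberConf F n hD))
    (hlift : ∀ γ : Path M M, ∃ s : C(unitInterval, Conf D n),
      ∀ t, Set.range (s t).1 = fiber F (γ t)) :
    IsBraidMonodromy F n hD M (FundamentalGroup.map ⟨fiberConf F n hD, hc⟩ M) := by
  intro γ
  obtain ⟨s, hs⟩ := hlift γ
  have hs' : ∀ t, (s t).toUConf = fiberConf F n hD (γ t) := fun t => Subtype.ext (hs t)
  refine ⟨s, (hs' 0).trans (congrArg _ γ.source), (hs' 1).trans (congrArg _ γ.target),
    fun t i => (hs t).le ⟨i, rfl⟩, ?_⟩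
  change loopClass (γ.map hc) = loopClass (strandPath s _ _)
  congr 1
  ext t
  exact (hs' t).symm

theorem loopClass_eq_of_torus {D : Set ℂ} {P : ℝ} {w : ℂ} (hDc : Convex ℝ D)
    (hD : Metric.closedBall 0 P ⊆ D) {η : ℝ} (hη : 0 < η)
    (hD' : Metric.closedBall 0 (P + η) ⊆ D) (hw : w ≠ 0) (hwP : ‖w‖ < P) (hw0 : 0 < w.re + w.im)
    (hw1 : w.re + w.im < P) (hlex : lexKey (-w) < lexKey w) {n : ℕ} (hn : 2 ≤ n) {K : UConf D 3}
    (hK : K.1 = {-w, w, (P : ℂ)}) (γ : Path K K)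
    (hγ : ∀ t : unitInterval, (γ t).1 = {-w * thirdTurn (3 / 2 * (n * t)),
      w * thirdTurn (3 / 2 * (n * t)), P * thirdTurn (3 * t)}) :
    loopClass γ = artinGen K 2 * artinGen K 1 * artinGen K 2 ^ n * artinGen K 1 * artinGen K 2 := by
  obtain rfl : (pairConf hw hwP hD).toUConf = K :=
    Subtype.ext ((pairConf_coe hw hwP hD).trans hK.symm)
  rw [← torusHom_eq hDc hD hη hD' hw hwP hw0 hw1 hlex hn rfl rfl]
  refine loopClass_eq_periodHom _ _ _ _ _ _ fun t => Subtype.ext ?_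
  rw [hγ, torusMap_coe]
  simp [mul_comm (t : ℝ)]

theorem IsTangentCurve.main (hF : IsTangentCurve F ν a ζ) (hν : 3 ≤ ν) (ha : 0 < a) {r : ℝ}
    (hr : 0 < r) (hN : closedBall 0 r ∩ branchSet F 3 = {0}) {c : ℂ} {R : ℝ}
    (hD : ∀ x ∈ closedBall 0 r, fiber F x ⊆ ball c R)
    (hD' : ∀ x ∈ closedBall 0 r, fiber F x ⊆ closedBall c R) {b : BraidGroup _}
    (hb : b = artinGen (fiberConf F 3 hD' (basePoint hr hN)) 2 *
      artinGen (fiberConf F 3 hD' (basePoint hr hN)) 1 *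
      artinGen (fiberConf F 3 hD' (basePoint hr hN)) 2 ^ ν *
      artinGen (fiberConf F 3 hD' (basePoint hr hN)) 1 *
      artinGen (fiberConf F 3 hD' (basePoint hr hN)) 2) :
    ∃ φ : FundamentalGroup ↥(closedBall 0 r \ branchSet F 3) (basePoint hr hN) →*
        BraidGroup (fiberConf F 3 hD' (basePoint hr hN)),
      IsBraidMonodromy F 3 hD' (basePoint hr hN) φ ∧
      φ (loopClass (circleLoop hr hN)) = b ∧ φ.range = Subgroup.zpowers b := by
  have hpow := hF.pow_lt hν ha hr hN
  have hν2 : 2 ≤ ν := by omega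
  have hexp : ∀ {u : ℂ}, ‖Complex.exp u‖ ≤ r → ‖Complex.exp u‖ ^ (ν - 2) < a ^ 2 := fun h =>
    (pow_le_pow_left₀ (norm_nonneg _) h _).trans_lt hpow
  let conf : {u : ℂ // ‖Complex.exp u‖ ≤ r} → Conf (closedBall c R) 3 := fun u =>
    ⟨sheets ν a ζ u.1, hF.injective_sheets hν2 ha (hexp u.2), fun i =>
      hD' _ (mem_closedBall_zero_iff.2 u.2) ((hF.fiber_exp u.1).ge ⟨i, rfl⟩)⟩
  have hconf : Continuous conf := Continuous.subtype_mk
    (continuous_pi fun i => (continuous_sheets i).comp continuous_subtype_val) _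
  have hc : Continuous (fiberConf F 3 hD') := by
    rw [continuous_iff_continuousAt]
    intro x₀
    have hx₀ := coe_ne_zero hN x₀
    have hlog : ∀ x : ↥(closedBall (0 : ℂ) r \ branchSet F 3),
        -- A logarithm that is continuous near `x₀` wherever `x₀` lies, since `x / x₀` is close to 1
        -- and thus away from the cut.
        Complex.exp (Complex.log (x / x₀) + Complex.log x₀) = x := by
      intro x
      rw [Complex.exp_add, Complex.exp_log (div_ne_zero (coe_ne_zero hN x) hx₀),
        Complex.exp_log hx₀]
      field_simp
    let L : ↥(closedBall (0 : ℂ) r \ branchSet F 3) → {u : ℂ // ‖Complex.exp u‖ ≤ r} := fun x =>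
      ⟨Complex.log (x / x₀) + Complex.log x₀, by
        rw [hlog]; exact mem_closedBall_zero_iff.1 x.2.1⟩
    have hL : ContinuousAt L x₀ := by
      have h1 : ContinuousAt (fun x : ↥(closedBall (0 : ℂ) r \ branchSet F 3) =>
          Complex.log ((x : ℂ) / x₀) + Complex.log x₀) x₀ := by
        refine ContinuousAt.add (ContinuousAt.clog ?_ ?_) continuousAt_const
        · exact (continuous_subtype_val.div_const _).continuousAt
        · rw [div_self hx₀]
          exact Complex.one_mem_slitPlane
      exact Topology.IsInducing.subtypeVal.continuousAt_iff.2 h1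
    have e : fiberConf F 3 hD' = fun x => (conf (L x)).toUConf := by
      funext x
      refine Subtype.ext ?_
      change fiber F x = Set.range (sheets ν a ζ (L x).1)
      rw [← hF.fiber_exp, hlog]
    rw [e]
    exact (Conf.continuous_toUConf.comp hconf).continuousAt.comp hL
  have hmono := isBraidMonodromy_map hD' (basePoint hr hN) hc (fun γ => by
    obtain ⟨u, hu, -⟩ := exists_log_path
      ⟨fun t => (γ t : ℂ), continuous_subtype_val.comp γ.continuous⟩
      (fun t => coe_ne_zero hN _) (Complex.log r)
      ((congrArg Subtype.val γ.source).trans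
        (Complex.exp_log (Complex.ofReal_ne_zero.2 hr.ne')).symm)
    simp only [ContinuousMap.coe_mk] at hu
    have hur : ∀ t, ‖Complex.exp (u t)‖ ≤ r := fun t => by
      rw [hu]
      exact mem_closedBall_zero_iff.1 (γ t).2.1
    refine ⟨⟨fun t => conf ⟨u t, hur t⟩, hconf.comp (u.continuous.subtype_mk hur)⟩, fun t => ?_⟩
    rw [← hu, hF.fiber_exp]
    rfl)
  have hcirc : FundamentalGroup.map ⟨fiberConf F 3 hD', hc⟩ (basePoint hr hN)
      (loopClass (circleLoop hr hN)) = b := by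
    -- The line $y=ax$ alone sweeps out the whole disc of radius $ar$ as $x$ runs through $E$, so
    -- `D` contains that disc in its interior. Compactness then gives the margin `η` needed for thin
    -- neighbourhoods.
    have hball : closedBall 0 (a * r) ⊆ ball c R := by
      intro y hy
      rw [mem_closedBall_zero_iff] at hy
      have ha' : (a : ℂ) ≠ 0 := Complex.ofReal_ne_zero.2 ha.ne'
      refine hD (y / a) ?_ ((hF.mem_fiber _ _).2 (Or.inr ?_))
      · rw [mem_closedBall_zero_iff, norm_div, Complex.norm_real, Real.norm_of_nonneg ha.le,
          div_le_iff₀ ha, mul_comm]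
        exact hy
      · field_simp
    obtain ⟨η, hη, hη'⟩ := (isCompact_closedBall (0 : ℂ) (a * r)).exists_cthickening_subset_open
      isOpen_ball hball
    rw [cthickening_closedBall hη.le (by positivity), add_comm] at hη'
    set ρ := Real.exp (ν * Real.log r / 2) with hρ
    have hρ0 : 0 < ρ := Real.exp_pos _
    have hexpr : Complex.exp (Real.log r) = r := by rw [← Complex.ofReal_exp, Real.exp_log hr]
    have hρ' : Complex.exp (ν * (Real.log r : ℝ) / 2) = ρ := by rw [hρ]; push_cast; rfl
    have hnorm : ‖ζ * ρ‖ = ρ := by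
      rw [norm_mul, hF.norm_eq, one_mul, Complex.norm_real, Real.norm_of_nonneg hρ0.le]
    have hρP : ρ < a * r := by
      have := hF.norm_lt hν2 ha (u := (Real.log r : ℝ)) (by
        rw [hexpr, Complex.norm_real, Real.norm_of_nonneg hr.le]; exact hpow)
      rw [hρ', hexpr, hnorm, ← Complex.ofReal_mul, Complex.norm_real,
        Real.norm_of_nonneg (by positivity)] at this
      exact this
    have hsum : (ζ * ρ).re + (ζ * ρ).im = ρ := by
      have := hF.re_add_im
      simp only [Complex.mul_re, Complex.mul_im, Complex.ofReal_re, Complex.ofReal_im, mul_zero,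
        sub_zero, zero_add, ← add_mul, this, one_mul]
    rw [hb]
    refine loopClass_eq_of_torus (w := ζ * ρ) (P := a * r) (convex_closedBall c R)
      (hball.trans ball_subset_closedBall) hη (hη'.trans ball_subset_closedBall)
      (mul_ne_zero hF.ne_zero (Complex.ofReal_ne_zero.2 hρ0.ne')) (hnorm.trans_lt hρP)
      (by rw [hsum]; exact hρ0) (by rw [hsum]; exact hρP) (hF.lex_lt ρ hρ0) hν2 ?_
      ((circleLoop hr hN).map hc) fun t => ?_
    · change fiber F (r : ℂ) = _
      rw [← hexpr, hF.fiber_exp, sheets, range_vec3, hρ', hexpr]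
      push_cast
      rfl
    · change fiber F (r * Complex.exp (2 * Real.pi * (t : ℝ) * Complex.I)) = _
      have h1 : ζ * Complex.exp (ν * ((Real.log r : ℝ) + 2 * Real.pi * (t : ℝ) * Complex.I) / 2) =
          ζ * ρ * thirdTurn (3 / 2 * (ν * t)) := by
        rw [mul_assoc ζ, ← hρ', thirdTurn, ← Complex.exp_add]
        congr 2
        push_cast
        ring
      have h2 : a * Complex.exp ((Real.log r : ℝ) + 2 * Real.pi * (t : ℝ) * Complex.I) =
          ((a * r : ℝ) : ℂ) * thirdTurn (3 * t) := by
        rw [Complex.exp_add, hexpr, thirdTurn, Complex.ofReal_mul, ← mul_assoc]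
        congr 2
        push_cast
        ring
      rw [← hexpr, ← Complex.exp_add, hF.fiber_exp, sheets, range_vec3, h1, h2, neg_mul]
  refine ⟨_, hmono, hcirc, ?_⟩
  -- The circle generates the source, so its image generates the range.
  rw [← hcirc, ← MonoidHom.map_zpowers, zpowers_circleLoop, MonoidHom.range_eq_map]

end Curve

end BraidMonodromy

end

open BraidMonodromy Metric
theorem mainTheorem10 (ν : ℕ) (hν : 3 ≤ ν) (a : ℝ) (ha : 0 < a)
    (F : Polynomial (Polynomial ℂ)) (hF : F = curveG1 ν a ∨ F = curveG2 ν a) :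
    F.natDegree = 3 ∧
    (∃ r₀ : ℝ, 0 < r₀ ∧ ∀ r : ℝ, 0 < r → r < r₀ → closedBall 0 r ∩ branchSet F 3 = {0}) ∧
    ∀ (r : ℝ) (hr : 0 < r) (hN : closedBall 0 r ∩ branchSet F 3 = {0})
      (c : ℂ) (R : ℝ) (hD : ∀ x ∈ closedBall 0 r, fiber F x ⊆ ball c R),
      let M := basePoint hr hN
      let hD' : ∀ x ∈ closedBall 0 r, fiber F x ⊆ closedBall c R :=
        fun x hx => (hD x hx).trans ball_subset_closedBall
      let σ₁ := artinGen (fiberConf F 3 hD' M) 1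
      let σ₂ := artinGen (fiberConf F 3 hD' M) 2
      ∃ φ : FundamentalGroup ↥(closedBall 0 r \ branchSet F 3) M →*
          BraidGroup (fiberConf F 3 hD' M),
        IsBraidMonodromy F 3 hD' M φ ∧
        φ (FundamentalGroup.fromPath (Path.Homotopic.Quotient.mk (circleLoop hr hN))) =
          σ₂ * σ₁ * σ₂ ^ ν * σ₁ * σ₂ ∧
        φ.range = Subgroup.zpowers (σ₂ * σ₁ * σ₂ ^ ν * σ₁ * σ₂) := by
  obtain ⟨ζ, hζ⟩ : ∃ ζ, IsTangentCurve F ν a ζ := by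
    rcases hF with rfl | rfl
    exacts [⟨_, isTangentCurve_curveG1 ν a⟩, ⟨_, isTangentCurve_curveG2 ν a⟩]
  refine ⟨?_, hζ.exists_radius hν ha, fun r hr hN c R hD => hζ.main hν ha hr hN hD _ rfl⟩
  rcases hF with rfl | rfl
  exacts [natDegree_curveG1 ν a, natDegree_curveG2 ν a]
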